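/- **Setting.** An instance consists of a finite set $A$ of applicants, a finite set of jobs, for every applicant $x$ a preference list (a set of acceptable jobs, each with a rank $r_x(p)\in\mathbb Z^+$; equal ranks are ties), and a weight $w(x)>0$ for every $x\in A$. Every applicant $x$ also has a private last resort job $l(x)$, which is on no other list and is ranked strictly worse than all other jobs on the list of $x$. $H$ is the bipartite graph joining applicants to the jobs on their lists (including $l(x)$). Applicant $x$ prefers job $p$ to $q$ if $r_x(p)<r_x(q)$; having any job on the list is preferred to having none. A matching $M$ of $H$ is *popular* if there is no matching $M'$ of $H$ such that the total weight of the applicants who prefer $M'$ to $M$ exceeds the total weight of those who prefer $M$ to $M'$. Let $w_1>\dots>w_k>0$ be the distinct weights and $C_i=\{x: w(x)=w_i\}$. A vertex is *critical* in a graph if it is matched in every maximum-cardinality matching of the graph. Define recursively: for $x\in C_i$, $f(x)$ is the set of best-ranked jobs among those on the list of $x$ that are non-critical in all of $G_1,\dots,G_{i-1}$; and $G_i$ has the edges $(x,p)$ with $x\in C_1\cup\dots\cup C_i$ and $p\in f(x)$. For $x\in C_i$, $s(x)$ is empty if $x$ is critical in $G_i$, and otherwise it is the set of best-ranked jobs among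 those on the list of $x$ that are non-critical in all of $G_1,\dots,G_i$. A matching $M$ of $H$ is *well-formed* if $M\cap E[G_i]$ is a maximum matching of $G_i$ for all $1\le i\le k$, and every applicant $x$ is matched to a job in $f(x)\cup s(x)$. **Procedure prune-ties.** For every $i$ let $M_i$ be an arbitrary maximum matching of $G_i$. The procedure starts with the graph with edges $(x,p)$, $p\in f(x)\cup s(x)$, and keeps labels $\lambda(p)$ of jobs. For a set $T$ of jobs, $\lambda_{\min}(x,T)$ is the minimum of $\lambda(q)$ over jobs $q$ on the list of $x$ that $x$ strictly prefers to the jobs of $T$; $\lambda_{\mathrm{equiv}}(x)$ is the minimum of $\lambda(q)$ over jobs $q\notin f(x)$ on the list of $x$ with the same rank as the jobs in $f(x)$. Here a minimum over the empty set is $\infty$. 1. Every job critical in $G_1$ gets the label $w_1$. 2. For $i=2,\dots,k$: (a) if $\lambda_{\min}(x,f(x))<w_i$ for some $x\in C_i$, stop and return "no popular matching exists"; (b) for every $x\in C_j$ with $j\le i$ that is non-critical in $G_i$, if $\lambda_{\min}(x,f(x))<w_j+w_i$ or $\lambda_{\mathrm{equiv}}(x)<w_i$, prune all edges between $x$ and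 $f(x)$; (c) every job $p$ that is critical in $G_i$ but non-critical in $G_1,\dots,G_{i-1}$ gets the label $\lambda(p)=\min\big(w_i,\ \min_{x\in S}\min\{\lambda_{\min}(x,f(x))-w(x),\ \lambda_{\mathrm{equiv}}(x)\}\big)$, where $S$ is the set of applicants $x$ that are critical in $G_i$ and reachable from $p$ by a simple path in $G_i$ that alternates with respect to $M_i$ and starts and ends with a matched edge. 3. For every $x\in A$ with $\lambda_{\min}(x,s(x))<w(x)$, prune all edges between $x$ and $s(x)$. Return the resulting graph $G'$. **Theorem.** For every choice of the maximum matchings $M_i$ the following holds. If prune-ties returns "no popular matching exists", then there is no popular matching. Otherwise, with $G'$ the returned graph, a matching $M$ of $H$ is popular if and only if $M$ is well-formed and $M\subseteq G'$. -/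

import Mathlib

noncomputable section

namespace BipMatching

variable {α β : Type*}

/-- `M` is a matching of the bipartite graph with edge set `E`. -/
def IsMatching (E M : Set (α × β)) : Prop :=
  M ⊆ E ∧ ∀ e ∈ M, ∀ e' ∈ M, e.1 = e'.1 ∨ e.2 = e'.2 → e = e'

/-- `M` is a matching of maximum cardinality of the (finite) bipartite graph `E`. -/
def IsMaximum (E M : Set (α × β)) : Prop :=
  IsMatching E M ∧ ∀ N, IsMatching E N → N.ncard ≤ M.ncard

/-- The left vertex `x` is critical: it is matched in every maximum matching of `E`. -/
def CriticalLeft (E : Set (α × β)) (x : α) : Prop :=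
  ∀ M, IsMaximum E M → ∃ p, (x, p) ∈ M

/-- The right vertex `p` is critical: it is matched in every maximum matching of `E`. -/
def CriticalRight (E : Set (α × β)) (p : β) : Prop :=
  ∀ M, IsMaximum E M → ∃ x, (x, p) ∈ M

/-- There is an alternating path `p = b 0, a 0, b 1, a 1, …, b n, a n = x` in the graph `E` with
respect to the matching `M` that starts and ends with a matched edge. The path is simple. -/
def AltPath (E M : Set (α × β)) (p : β) (x : α) : Prop :=
  ∃ (n : ℕ) (a : ℕ → α) (b : ℕ → β),
    b 0 = p ∧ a n = x ∧ Set.InjOn a (Set.Iic n) ∧ Set.InjOn b (Set.Iic n) ∧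
    (∀ j ≤ n, (a j, b j) ∈ M) ∧ ∀ j < n, (a j, b (j + 1)) ∈ E \ M

end BipMatching

open BipMatching

/-- A weighted instance: the set `E` of pairs `(x, p)` such that job `p` is on the preference list
of applicant `x`, the rank `r_x(p) ≥ 1` of `p` on that list (ties allowed; only the values on `E`
matter), and a positive weight for every applicant. -/
structure PrefInstance (A J : Type*) where
  E : Set (A × J)
  rank : A → J → ℕ+
  weight : A → ℝ
  weight_pos : ∀ x, 0 < weight x

namespace PrefInstance

variable {A J : Type*} (I : PrefInstance A J)

/-! The instance with last resort jobs: the jobs are `J ⊕ A`, where `Sum.inr x` is the last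
resort job `l(x)`, placed strictly at the end of the list of `x` and on no other list. -/

/-- The preference list of `x`, as a set of jobs, including the last resort job `l(x)`. -/
def jobList (x : A) : Set (J ⊕ A) :=
  {p | (∃ q, p = Sum.inl q ∧ (x, q) ∈ I.E) ∨ p = Sum.inr x}

/-- The rank of a job for `x`; the last resort job comes after all other jobs. -/
def rk (x : A) : J ⊕ A → WithTop ℕ+
  | Sum.inl p => (I.rank x p : WithTop ℕ+)
  | Sum.inr _ => ⊤

/-- The edges of the instance with last resort jobs. -/
def H : Set (A × (J ⊕ A)) := {e | e.2 ∈ I.jobList e.1}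

/-- `x` prefers `M` over `N`: the job of `x` in `M` is better than the job of `x` in `N`, if `x`
has one in `N` (being matched is better than being free). -/
def Prefers (x : A) (M N : Set (A × (J ⊕ A))) : Prop :=
  ∃ p, (x, p) ∈ M ∧ ∀ q, (x, q) ∈ N → I.rk x p < I.rk x q

open Classical in
/-- The satisfaction of `M` with respect to `N`. -/
def satisfaction [Fintype A] (M N : Set (A × (J ⊕ A))) : ℝ :=
  (∑ x : A, if I.Prefers x M N then I.weight x else 0) -
    ∑ x : A, if I.Prefers x N M then I.weight x else 0

/-- `M` is a popular matching: no matching is more popular than `M`. -/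
def Popular [Fintype A] (M : Set (A × (J ⊕ A))) : Prop :=
  IsMatching I.H M ∧ ¬ ∃ N, IsMatching I.H N ∧ 0 < I.satisfaction N M

open Classical in
/-- The distinct weights `w_1 > w_2 > … > w_k`, in decreasing order. -/
def weights [Fintype A] : List ℝ := (Finset.univ.image I.weight).sort (· ≥ ·)

/-- The number `k` of categories. -/
def k [Fintype A] : ℕ := I.weights.length

/-- The weight `w_i` of category `i`, for `1 ≤ i ≤ k`. -/
def wt [Fintype A] (i : ℕ) : ℝ := I.weights.getD (i - 1) 0

open Classical in
/-- The category of `x`: `x ∈ C_i` means `I.cat x = i`, where `1 ≤ i ≤ k`. -/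
def cat [Fintype A] (x : A) : ℕ := I.weights.idxOf (I.weight x) + 1

/-- The jobs of `S` on the list of `x` that have the best rank for `x` among these jobs. -/
def best (x : A) (S : Set (J ⊕ A)) : Set (J ⊕ A) :=
  {p | p ∈ I.jobList x ∩ S ∧ ∀ q ∈ I.jobList x ∩ S, I.rk x p ≤ I.rk x q}

/-- The graph `G_i`: its edges join every applicant `x ∈ C_j` with `j ≤ i` to the jobs in `f(x)`,
the best jobs on the list of `x` that are non-critical in `G_1, …, G_{j-1}`.
The graph `G_0` has no edges. See `mem_G_iff`. -/
def G [Fintype A] (i : ℕ) : Set (A × (J ⊕ A)) :=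
  {e | ∃ _ : I.cat e.1 ≤ i,
    e.2 ∈ I.best e.1 {p | ∀ j, ∀ _ : j < I.cat e.1, ¬ CriticalRight (G j) p}}
termination_by i
decreasing_by omega

/-- The first jobs `f(x)`. -/
def first [Fintype A] (x : A) : Set (J ⊕ A) :=
  I.best x {p | ∀ j < I.cat x, ¬ CriticalRight (I.G j) p}

/-- The second jobs `s(x)`: for `x ∈ C_i` non-critical in `G_i`, the best jobs on the list of `x`
that are non-critical in `G_1, …, G_i`; for `x ∈ C_i` critical in `G_i`, the empty set. -/
def second [Fintype A] (x : A) : Set (J ⊕ A) :=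
  {p | ¬ CriticalLeft (I.G (I.cat x)) x ∧
    p ∈ I.best x {p | ∀ j ≤ I.cat x, ¬ CriticalRight (I.G j) p}}

theorem mem_G_iff [Fintype A] (i : ℕ) (e : A × (J ⊕ A)) :
    e ∈ I.G i ↔ I.cat e.1 ≤ i ∧ e.2 ∈ I.first e.1 := by
  rw [G]
  simp [first]

theorem wt_cat [Fintype A] (x : A) : I.wt (I.cat x) = I.weight x := by
  classical
  have h : I.weight x ∈ I.weights := by simp [weights]
  have h' : I.weights.idxOf (I.weight x) < I.weights.length := List.idxOf_lt_length_iff.2 h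
  simp only [wt, cat, Nat.add_sub_cancel]
  convert List.getD_eq_getElem _ _ h' using 1
  exact (List.getElem_idxOf h').symm

/-- A matching is well-formed if `M_i = M ∩ E[G_i]` is maximum in `G_i` for all `1 ≤ i ≤ k`, and
every applicant `x` is matched within `f(x) ∪ s(x)`. -/
def WellFormed [Fintype A] (M : Set (A × (J ⊕ A))) : Prop :=
  IsMatching I.H M ∧
    (∀ i, 1 ≤ i → i ≤ I.k → IsMaximum (I.G i) (M ∩ I.G i)) ∧
    ∀ x, ∃ p, (x, p) ∈ M ∧ p ∈ I.first x ∪ I.second x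

/-- `λ_min(x, T)` for a labelling `lab`: the least label of a job on the list of `x` that `x`
prefers over the jobs of `T`, and `∞` if there is no such job. -/
def lamMin (lab : J ⊕ A → EReal) (x : A) (T : Set (J ⊕ A)) : EReal :=
  ⨅ q ∈ {q | q ∈ I.jobList x ∧ ∀ p ∈ T, I.rk x q < I.rk x p}, lab q

/-- `λ_equiv(x)` for a labelling `lab`: the least label of a job on the list of `x` that is not in
`f(x)` but has the same rank as the jobs in `f(x)`, and `∞` if there is no such job. -/
def lamEquiv [Fintype A] (lab : J ⊕ A → EReal) (x : A) : EReal :=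
  ⨅ q ∈ {q | q ∈ I.jobList x ∧ q ∉ I.first x ∧ ∃ p ∈ I.first x, I.rk x q = I.rk x p}, lab q

/-- The state of the procedure `prune-ties`: the labels `λ(p)` (with `∞` for jobs that have not
been labelled yet) and the edges that have not been pruned yet. -/
structure PruneState (A J : Type*) where
  lab : J ⊕ A → EReal
  edges : Set (A × (J ⊕ A))

open Classical in
/-- The start of `prune-ties`: critical jobs in `G_1` get label `w_1`, and the graph is `G`, with
the edges between applicants and their first and second jobs. -/
def pruneInit [Fintype A] : PruneState A J where
  lab p := if CriticalRight (I.G 1) p then (I.wt 1 : EReal) else ⊤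
  edges := {e | e.2 ∈ I.first e.1 ∪ I.second e.1}

open Classical in
/-- Iteration `i ≥ 2` of `prune-ties`, where `N` is the maximum matching of `G_i` with respect to
which alternating paths are taken. The value `none` stands for the answer
"no popular matching exists". -/
def pruneStep [Fintype A] (i : ℕ) (N : Set (A × (J ⊕ A))) (s : PruneState A J) :
    Option (PruneState A J) :=
  if ∃ x, I.cat x = i ∧ I.lamMin s.lab x (I.first x) < (I.wt i : EReal) then none
  else some
    { edges := s.edges \ {e | I.cat e.1 ≤ i ∧ ¬ CriticalLeft (I.G i) e.1 ∧ e.2 ∈ I.first e.1 ∧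
        (I.lamMin s.lab e.1 (I.first e.1) < ((I.weight e.1 + I.wt i : ℝ) : EReal) ∨
          I.lamEquiv s.lab e.1 < (I.wt i : EReal))}
      lab := fun p =>
        if CriticalRight (I.G i) p ∧ ∀ j < i, ¬ CriticalRight (I.G j) p then
          min (I.wt i : EReal)
            (⨅ x ∈ {x | CriticalLeft (I.G i) x ∧ AltPath (I.G i) N p x},
              min (I.lamMin s.lab x (I.first x) - (I.weight x : EReal)) (I.lamEquiv s.lab x))
        else s.lab p }

/-- The last loop of `prune-ties`: it prunes the edges between `x` and `s(x)` for all applicants `x`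
with `λ_min(x, s(x)) < w(x)`. -/
def pruneFinal [Fintype A] (s : PruneState A J) : Set (A × (J ⊕ A)) :=
  s.edges \ {e | I.lamMin s.lab e.1 (I.second e.1) < (I.weight e.1 : EReal) ∧
    e.2 ∈ I.second e.1}

/-- The procedure `prune-ties`, where `N i` is the maximum matching of `G_i` used in iteration
`i = 2, …, k`. It returns either "no popular matching exists" (`none`) or the pruned graph. -/
def pruneTies [Fintype A] (N : ℕ → Set (A × (J ⊕ A))) : Option (Set (A × (J ⊕ A))) :=
  ((List.range' 2 (I.k - 1)).foldlM (fun s i => I.pruneStep i (N i) s) I.pruneInit).map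
    I.pruneFinal

end PrefInstance

end

/-!
Whether a matching `M` that matches every applicant is popular is decided by an assignment problem,
and linear programming duality turns popularity into the existence of a certificate
(`IsCertificate`): nonnegative values `β p` of the jobs, zero on free jobs and at most `w(x)` on the
job of `x`, that rise by `w(x)` from the job of `x` to every better job on the list of `x`, and do
not fall from it to an equally ranked one. Summing these inequalities shows that a certificate
implies popularity (`popular_of_isCertificate`). Conversely, shortest path lengths in the exchange
graph of a popular matching are a certificate (`exists_isCertificate`).

A certificate of a popular matching `M` forces `M` to be well-formed. Jobs of positive value are
first jobs of their applicants (`mem_first_of_pos`), so the jobs of value at least `w_i` yield a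
vertex cover of `G_i` of the size of `M ∩ E[G_i]` (`isMaximum`). By induction along the procedure,
every label is an upper bound for the value of its job (`le_lab`): alternating paths in `G_i` do not
decrease values, so that every term in the definition of a label is such a bound. Here it matters
that the critical applicants reachable from a critical job are the same for all maximum matchings of
`G_i` (`AltPath.of_isMaximum`). Hence the procedure does not stop early and prunes no edge of `M`
(`subset_pruneFinal`).

If, on the other hand, `M` is well-formed and avoids the pruned edges, then the labels themselves,
extended by zero to the jobs that are critical in no graph, are a certificate
(`isCertificate_labelValue`). The delicate inequality is the one between two first jobs of an
applicant (`labelValue_le_of_mem_first`); the others are built into the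
labels and the pruning rules.
-/

open BipMatching

/-! ### Matchings and critical vertices -/

namespace BipMatching

variable {α β : Type*} {E M N : Set (α × β)}

theorem IsMatching.left_unique (h : IsMatching E M) {a a' : α} {b : β}
    (h₁ : (a, b) ∈ M) (h₂ : (a', b) ∈ M) : a = a' :=
  congrArg Prod.fst (h.2 _ h₁ _ h₂ (Or.inr rfl))

theorem IsMatching.right_unique (h : IsMatching E M) {a : α} {b b' : β}
    (h₁ : (a, b) ∈ M) (h₂ : (a, b') ∈ M) : b = b' :=
  congrArg Prod.snd (h.2 _ h₁ _ h₂ (Or.inl rfl))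

theorem IsMatching.injOn_fst (h : IsMatching E M) : Set.InjOn Prod.fst M :=
  fun e he e' he' h' => h.2 e he e' he' (Or.inl h')

theorem IsMatching.injOn_snd (h : IsMatching E M) : Set.InjOn Prod.snd M :=
  fun e he e' he' h' => h.2 e he e' he' (Or.inr h')

theorem isMatching_swap_iff : IsMatching (Prod.swap ⁻¹' E) (Prod.swap ⁻¹' M) ↔ IsMatching E M := by
  constructor
  · rintro ⟨h₁, h₂⟩
    refine ⟨fun e he => h₁ (a := e.swap) (by simpa using he), fun e he e' he' h => ?_⟩
    exact Prod.swap_injective (h₂ e.swap (by simpa using he) e'.swap (by simpa using he') h.symm)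
  · rintro ⟨h₁, h₂⟩
    refine ⟨fun e he => h₁ he, fun e he e' he' h => ?_⟩
    exact Prod.swap_injective (h₂ e.swap he e'.swap he' h.symm)

theorem ncard_swap_preimage (M' : Set (α × β)) : (Prod.swap ⁻¹' M').ncard = M'.ncard :=
  Set.ncard_preimage_of_injective_subset_range Prod.swap_injective
    fun e _ => ⟨e.swap, Prod.swap_swap e⟩

theorem isMaximum_swap_iff : IsMaximum (Prod.swap ⁻¹' E) (Prod.swap ⁻¹' M) ↔ IsMaximum E M := by
  unfold IsMaximum
  rw [isMatching_swap_iff, ncard_swap_preimage]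
  refine and_congr_right fun _ => ⟨fun h N hN => ?_, fun h N hN => ?_⟩
  · rw [← ncard_swap_preimage]
    exact h _ (isMatching_swap_iff.2 hN)
  · rw [← ncard_swap_preimage]
    exact h _ (isMatching_swap_iff.1 hN)

theorem criticalRight_swap_iff {a : α} :
    CriticalRight (Prod.swap ⁻¹' E) a ↔ CriticalLeft E a :=
  ⟨fun h _ hM => h _ (isMaximum_swap_iff.2 hM),
    fun h M' hM => h (Prod.swap ⁻¹' M') (isMaximum_swap_iff.1 hM)⟩

theorem exists_isMaximum [Finite α] [Finite β] (E : Set (α × β)) : ∃ M, IsMaximum E M := by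
  obtain ⟨M, hM, h⟩ := Set.exists_max_image {M | IsMatching E M} Set.ncard (Set.toFinite _)
    ⟨∅, Set.empty_subset _, by simp⟩
  exact ⟨M, hM, h⟩

theorem IsMatching.ncard_snd_mem {R : Set β} (hM : IsMatching E M)
    (hR : ∀ p ∈ R, ∃ a, (a, p) ∈ M) : {e ∈ M | e.2 ∈ R}.ncard = R.ncard := by
  rw [← (hM.injOn_snd.mono (Set.sep_subset _ _)).ncard_image]
  congr 1
  ext p
  constructor
  · rintro ⟨e, ⟨_, he⟩, rfl⟩
    exact he
  · intro hp
    obtain ⟨a, ha⟩ := hR p hp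
    exact ⟨(a, p), ⟨ha, hp⟩, rfl⟩

section Closed

variable [Finite α] [Finite β]

theorem ncard_sep_add_ncard_sep (M' : Set (α × β)) (R : Set β) :
    {e ∈ M' | e.2 ∈ R}.ncard + {e ∈ M' | e.2 ∉ R}.ncard = M'.ncard := by
  rw [← Set.ncard_union_eq]
  · congr 1
    ext e
    by_cases h : e.2 ∈ R <;> simp [h]
  · rw [Set.disjoint_left]
    exact fun e h h' => h'.2 h.2

/-- If `M` matches every vertex of `R`, and the partners of `R` have no neighbours outside `R`, then
every vertex of `R` is critical: otherwise a maximum matching that misses a vertex of `R` could be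
enlarged by replacing its edges at `R` by those of `M`. The matching `M` need not be maximum. -/
theorem criticalRight_of_closed {R : Set β} (hM : IsMatching E M) (hR : ∀ p ∈ R, ∃ a, (a, p) ∈ M)
    (hc : ∀ a p p', p ∈ R → (a, p) ∈ M → (a, p') ∈ E → p' ∈ R) {p : β} (hp : p ∈ R) :
    CriticalRight E p := by
  intro N hN
  by_contra hpN
  have hN' : IsMatching E ({e ∈ N | e.2 ∉ R} ∪ {e ∈ M | e.2 ∈ R}) := by
    have key : ∀ e ∈ N, e.2 ∉ R → ∀ e' ∈ M, e'.2 ∈ R → ¬ (e.1 = e'.1 ∨ e.2 = e'.2) := by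
      rintro ⟨a, q⟩ he hq ⟨a', q'⟩ he' hq' (h | h)
      · simp only at h hq hq'
        subst h
        exact hq (hc a q' q hq' he' (hN.1.1 he))
      · simp only at h hq hq'
        exact hq (h ▸ hq')
    constructor
    · rintro e (he | he)
      · exact hN.1.1 he.1
      · exact hM.1 he.1
    · rintro e (he | he) e' (he' | he') h
      · exact hN.1.2 e he.1 e' he'.1 h
      · exact absurd h (key e he.1 he.2 e' he'.1 he'.2)
      · exact absurd (h.imp Eq.symm Eq.symm) (key e' he'.1 he'.2 e he.1 he.2)
      · exact hM.2 e he.1 e' he'.1 h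
  have h₁ := hN.2 _ hN'
  rw [Set.ncard_union_eq, hM.ncard_snd_mem hR, ← ncard_sep_add_ncard_sep N R] at h₁
  · have h₂ : {e ∈ N | e.2 ∈ R}.ncard < R.ncard := by
      rw [← (hN.1.injOn_snd.mono (Set.sep_subset _ _)).ncard_image]
      refine Set.ncard_lt_ncard ⟨?_, fun h => ?_⟩
      · rintro _ ⟨e, he, rfl⟩
        exact he.2
      · obtain ⟨e, he, rfl⟩ := h hp
        exact hpN ⟨e.1, he.1⟩
    omega
  · rw [Set.disjoint_left]
    exact fun e h h' => h.2 h'.2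

/-- The counterpart of `criticalRight_of_closed` on the left side. -/
theorem criticalLeft_of_closed {Z : Set α} (hM : IsMatching E M) (hZ : ∀ a ∈ Z, ∃ p, (a, p) ∈ M)
    (hc : ∀ a a' p, a ∈ Z → (a, p) ∈ M → (a', p) ∈ E → a' ∈ Z) {a : α} (ha : a ∈ Z) :
    CriticalLeft E a := by
  rw [← criticalRight_swap_iff]
  exact criticalRight_of_closed (isMatching_swap_iff.2 hM) hZ
    (fun p a a' h h₁ h₂ => hc a a' p h h₁ h₂) ha

/-- König's criterion: `R` together with the left vertices that `M` matches outside `R` is a vertex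
cover of the size of `M`. -/
theorem isMaximum_of_closed {R : Set β} (hM : IsMatching E M) (hR : ∀ p ∈ R, ∃ a, (a, p) ∈ M)
    (hc : ∀ a p p', p ∈ R → (a, p) ∈ M → (a, p') ∈ E → p' ∈ R)
    (hf : ∀ a p, (a, p) ∈ E → (∀ p', (a, p') ∉ M) → p ∈ R) : IsMaximum E M := by
  refine ⟨hM, fun N hN => ?_⟩
  rw [← ncard_sep_add_ncard_sep N R, ← ncard_sep_add_ncard_sep M R, hM.ncard_snd_mem hR]
  refine add_le_add ?_ ?_
  · rw [← (hN.injOn_snd.mono (Set.sep_subset _ _)).ncard_image]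
    refine Set.ncard_le_ncard ?_
    rintro _ ⟨e, he, rfl⟩
    exact he.2
  · rw [← (hN.injOn_fst.mono (Set.sep_subset _ _)).ncard_image,
      ← (hM.injOn_fst.mono (Set.sep_subset _ _)).ncard_image]
    refine Set.ncard_le_ncard ?_
    rintro _ ⟨⟨a, q⟩, he, rfl⟩
    by_cases h : ∃ p, (a, p) ∈ M
    · obtain ⟨p, hp⟩ := h
      exact ⟨(a, p), ⟨hp, fun hpR => he.2 (hc a p q hpR hp (hN.1 he.1))⟩, rfl⟩
    · push Not at h
      exact absurd (hf a q (hN.1 he.1) h) he.2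

end Closed

/-- One step of an alternating path between right vertices: from `p` along an edge of `M` to its
partner, then along an edge of `E`. -/
def Step (E M : Set (α × β)) (p p' : β) : Prop := ∃ a, (a, p) ∈ M ∧ (a, p') ∈ E

theorem exists_simple_path_of_reflTransGen {γ : Type*} {r : γ → γ → Prop} {p q : γ}
    (h : Relation.ReflTransGen r p q) :
    ∃ (n : ℕ) (b : ℕ → γ), b 0 = p ∧ b n = q ∧ Set.InjOn b (Set.Iic n) ∧
      ∀ j < n, r (b j) (b (j + 1)) := by
  induction h using Relation.ReflTransGen.head_induction_on with
  | refl => exact ⟨0, fun _ => q, rfl, rfl, fun i hi j hj _ => by simp at hi hj; omega, by simp⟩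
  | @head p p₁ hp _ ih =>
    obtain ⟨n, b, rfl, rfl, hb, hr⟩ := ih
    by_cases h : ∃ i ≤ n, b i = p
    · obtain ⟨i, hi, rfl⟩ := h
      refine ⟨n - i, fun j => b (i + j), rfl, congrArg b (by omega), ?_, ?_⟩
      · intro j hj j' hj' hjj
        simp only [Set.mem_Iic] at hj hj'
        have := hb (show i + j ∈ Set.Iic n by simp only [Set.mem_Iic]; omega)
          (show i + j' ∈ Set.Iic n by simp only [Set.mem_Iic]; omega) hjj
        omega
      · intro j hj
        exact hr (i + j) (by omega)
    · push Not at h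
      refine ⟨n + 1, fun j => Nat.casesOn j p b, rfl, rfl, ?_, ?_⟩
      · rintro (_ | j) hj (_ | j') hj' hjj
        · rfl
        · exact absurd hjj.symm (h j' (by simpa using hj'))
        · exact absurd hjj (h j (by simpa using hj))
        · have := hb (show j ∈ Set.Iic n by simpa using hj)
            (show j' ∈ Set.Iic n by simpa using hj') hjj
          omega
      · rintro (_ | j) hj
        · exact hp
        · exact hr j (by omega)

theorem altPath_iff (hM : IsMatching E M) {p : β} {x : α} :
    AltPath E M p x ↔ ∃ q, Relation.ReflTransGen (Step E M) p q ∧ (x, q) ∈ M := by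
  constructor
  · rintro ⟨n, a, b, rfl, rfl, -, -, h₁, h₂⟩
    refine ⟨b n, ?_, h₁ n le_rfl⟩
    have : ∀ j ≤ n, Relation.ReflTransGen (Step E M) (b 0) (b j) := by
      intro j
      induction j with
      | zero => exact fun _ => .refl
      | succ j ih => exact fun hj => (ih (by omega)).tail ⟨a j, h₁ j (by omega), (h₂ j hj).1⟩
    exact this n le_rfl
  · rintro ⟨q, h, hx⟩
    obtain ⟨n, b, rfl, rfl, hb, hr⟩ := exists_simple_path_of_reflTransGen h
    have hr' : ∀ j, ∃ a, j ≤ n → (a, b j) ∈ M ∧ (j < n → (a, b (j + 1)) ∈ E) := by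
      intro j
      rcases lt_trichotomy j n with hj | rfl | hj
      · obtain ⟨a, h₁, h₂⟩ := hr j hj
        exact ⟨a, fun _ => ⟨h₁, fun _ => h₂⟩⟩
      · exact ⟨x, fun _ => ⟨hx, fun h => absurd h (lt_irrefl _)⟩⟩
      · exact ⟨x, fun h => by omega⟩
    choose a ha using hr'
    refine ⟨n, a, b, rfl, hM.left_unique (ha n le_rfl).1 hx, ?_, hb, fun j hj => (ha j hj).1, ?_⟩
    · intro i hi j hj hij
      exact hb hi hj (hM.right_unique (hij ▸ (ha i hi).1) (ha j hj).1)
    · intro j hj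
      refine ⟨(ha j hj.le).2 hj, fun hjM => ?_⟩
      have := hb (show j + 1 ∈ Set.Iic n by simpa using hj) (show j ∈ Set.Iic n by simpa using hj.le)
        (hM.right_unique hjM (ha j hj.le).1)
      omega

/-- Replacing an edge of a maximum matching by an edge to a free vertex. -/
theorem IsMaximum.exchange [Finite α] [Finite β] (hM : IsMaximum E M) {a : α} {p q : β}
    (hp : (a, p) ∈ M) (hq : (a, q) ∈ E) (hf : ∀ a', (a', q) ∉ M) :
    IsMaximum E (insert (a, q) (M \ {(a, p)})) := by
  have hcard : (insert (a, q) (M \ {(a, p)})).ncard = M.ncard :=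
    Set.ncard_exchange (hf a) hp
  refine ⟨⟨?_, ?_⟩, fun N hN => hcard ▸ hM.2 N hN⟩
  · rintro e (rfl | he)
    · exact hq
    · exact hM.1.1 he.1
  · have key : ∀ e ∈ M \ {(a, p)}, ¬ ((a, q).1 = e.1 ∨ (a, q).2 = e.2) := by
      rintro ⟨a', p'⟩ ⟨he, he'⟩ (h | h)
      · simp only at h
        subst h
        exact he' (by rw [hM.1.right_unique he hp]; rfl)
      · simp only at h
        subst h
        exact hf a' he
    rintro e (rfl | he) e' (rfl | he') h
    · rfl
    · exact absurd h (key e' he')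
    · exact absurd (h.imp Eq.symm Eq.symm) (key e he)
    · exact hM.1.2 e he.1 e' he'.1 h

/-- Shifting a maximum matching along an alternating path that ends in a free vertex frees the first
vertex of the path, so every vertex reached from a critical one is matched. -/
theorem IsMaximum.exists_mem_of_reach_right [Finite α] [Finite β] (hM : IsMaximum E M) {p q : β}
    (hp : CriticalRight E p) (h : Relation.ReflTransGen (Step E M) p q) : ∃ a, (a, q) ∈ M := by
  by_contra hq
  obtain ⟨n, b, rfl, rfl, hb, hr⟩ := exists_simple_path_of_reflTransGen h
  clear h
  induction n generalizing M with
  | zero => exact hq (hp M hM)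
  | succ n ih =>
    push Not at hq
    obtain ⟨a, h₁, h₂⟩ := hr n (by omega)
    have hM' := hM.exchange h₁ h₂ hq
    have hne : ∀ j ≤ n + 1, j ≠ n → b j ≠ b n := fun j hj hjn h =>
      hjn (hb (show j ∈ Set.Iic (n + 1) from hj) (show n ∈ Set.Iic (n + 1) by simp) h)
    refine ih hM' ?_ (hb.mono (Set.Iic_subset_Iic.2 (by omega))) ?_
    · rintro ⟨a', (h | h)⟩
      · exact hne (n + 1) le_rfl (by omega) (congrArg Prod.snd h).symm
      · exact h.2 (by rw [hM.1.left_unique h.1 h₁]; rfl)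
    · intro j hj
      obtain ⟨a', h₃, h₄⟩ := hr j (by omega)
      exact ⟨a', Or.inr ⟨h₃, fun h => hne j (by omega) (by omega) (congrArg Prod.snd h)⟩, h₄⟩

theorem IsMaximum.exists_mem_of_reach_left [Finite α] [Finite β] (hM : IsMaximum E M) {x y : α}
    (hx : CriticalLeft E x)
    (h : Relation.ReflTransGen (Step (Prod.swap ⁻¹' E) (Prod.swap ⁻¹' M)) x y) :
    ∃ p, (y, p) ∈ M :=
  (isMaximum_swap_iff.2 hM).exists_mem_of_reach_right (criticalRight_swap_iff.2 hx) h

/-- The vertices reached from a critical vertex are matched, so they form a closed set. -/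
theorem IsMaximum.criticalRight_of_step [Finite α] [Finite β] (hM : IsMaximum E M) {p q : β}
    (hp : CriticalRight E p) (h : Step E M p q) : CriticalRight E q :=
  criticalRight_of_closed (R := {r | Relation.ReflTransGen (Step E M) p r}) hM.1
    (fun _ hr => hM.exists_mem_of_reach_right hp hr)
    (fun a _ _ hr h₁ h₂ => Relation.ReflTransGen.tail hr ⟨a, h₁, h₂⟩) (Relation.ReflTransGen.single h)

/-- Whether the critical left vertex `x` can be reached from the critical right vertex `p` does not
depend on the maximum matching. The vertices reached from `p` with respect to `N`, and the vertices
from which `x` is reached with respect to `M`, are perfectly matched among each other by `N` and by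
`M`, respectively. Counting shows that `M` matches the intersection of these two sets within itself,
so that an `M`-alternating path from `p` to `x` never leaves the first set. -/
theorem AltPath.of_isMaximum [Finite α] [Finite β] (hM : IsMaximum E M) (hN : IsMaximum E N)
    {p : β} {x : α} (hp : CriticalRight E p) (hx : CriticalLeft E x) (h : AltPath E M p x) :
    AltPath E N p x := by
  rw [altPath_iff hM.1] at h
  rw [altPath_iff hN.1]
  obtain ⟨q₀, hpath, hq₀⟩ := h
  let R : Set β := {q | Relation.ReflTransGen (Step E N) p q}
  let X : Set α := {a | ∃ q ∈ R, (a, q) ∈ N}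
  let Z : Set α := {a | Relation.ReflTransGen (Step (Prod.swap ⁻¹' E) (Prod.swap ⁻¹' M)) x a}
  let Q : Set β := {q | ∃ a ∈ Z, (a, q) ∈ M}
  have hR : ∀ q ∈ R, ∃ a, (a, q) ∈ N := fun q hq => hN.exists_mem_of_reach_right hp hq
  have hXR : ∀ a q, a ∈ X → (a, q) ∈ E → q ∈ R := by
    rintro a q ⟨r, hr, har⟩ haq
    exact Relation.ReflTransGen.tail hr ⟨a, har, haq⟩
  have hZ : ∀ a ∈ Z, ∃ q, (a, q) ∈ M := fun a ha => hM.exists_mem_of_reach_left hx ha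
  have hQZ : ∀ a q, q ∈ Q → (a, q) ∈ E → a ∈ Z := by
    rintro a q ⟨a', ha', h'⟩ haq
    exact Relation.ReflTransGen.tail ha' ⟨q, h', haq⟩
  have hf : ∀ q, ∃ a, q ∈ R ∩ Q → a ∈ X ∩ Z ∧ (a, q) ∈ N := by
    intro q
    by_cases hq : q ∈ R ∩ Q
    · obtain ⟨a, ha⟩ := hR q hq.1
      exact ⟨a, fun _ => ⟨⟨⟨q, hq.1, ha⟩, hQZ a q hq.2 (hN.1.1 ha)⟩, ha⟩⟩
    · exact ⟨x, fun h => absurd h hq⟩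
  choose f hf using hf
  have hg : ∀ a, ∃ q, a ∈ X ∩ Z → q ∈ R ∩ Q ∧ (a, q) ∈ M := by
    intro a
    by_cases ha : a ∈ X ∩ Z
    · obtain ⟨q, hq⟩ := hZ a ha.2
      exact ⟨q, fun _ => ⟨⟨hXR a q ha.1 (hM.1.1 hq), a, ha.2, hq⟩, hq⟩⟩
    · exact ⟨p, fun h => absurd h ha⟩
  choose g hg using hg
  have hle : (R ∩ Q).ncard ≤ (X ∩ Z).ncard := by
    refine Set.ncard_le_ncard_of_injOn f (fun q hq => (hf q hq).1) fun q hq q' hq' h => ?_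
    exact hN.1.right_unique (hf q hq).2 (h ▸ (hf q' hq').2)
  have hsurj : ∀ q ∈ R ∩ Q, ∃ a ∈ X ∩ Z, (a, q) ∈ M := by
    intro q hq
    have himg : g '' (X ∩ Z) = R ∩ Q := by
      refine Set.eq_of_subset_of_ncard_le ?_ ?_
      · rintro _ ⟨a, ha, rfl⟩
        exact (hg a ha).1
      · rw [Set.InjOn.ncard_image]
        · exact hle
        · intro a ha a' ha' h
          exact hM.1.left_unique (hg a ha).2 (h ▸ (hg a' ha').2)
    obtain ⟨a, ha, rfl⟩ := himg.symm ▸ hq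
    exact ⟨a, ha, (hg a ha).2⟩
  have key : ∀ q, Relation.ReflTransGen (Step E M) q q₀ → q ∈ Q ∧ (q ∈ R → x ∈ X) := by
    intro q hq
    induction hq using Relation.ReflTransGen.head_induction_on with
    | refl =>
      refine ⟨⟨x, Relation.ReflTransGen.refl, hq₀⟩, fun hq => ?_⟩
      obtain ⟨a, ha, haq⟩ := hsurj q₀ ⟨hq, x, Relation.ReflTransGen.refl, hq₀⟩
      rw [← hM.1.left_unique haq hq₀]
      exact ha.1
    | @head q q₁ hqq _ ih =>
      obtain ⟨a, h₁, h₂⟩ := hqq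
      have hq : q ∈ Q := ⟨a, hQZ a q₁ ih.1 h₂, h₁⟩
      refine ⟨hq, fun hqR => ih.2 ?_⟩
      obtain ⟨a', ha', haq⟩ := hsurj q ⟨hqR, hq⟩
      obtain rfl := hM.1.left_unique haq h₁
      exact hXR a' q₁ ha'.1 h₂
  exact (key p hpath).2 Relation.ReflTransGen.refl

end BipMatching

namespace PrefInstance

variable {A J : Type*} (I : PrefInstance A J) {M : Set (A × (J ⊕ A))}

/-! ### Preference lists and ranks -/

theorem rk_eq_of_mem_best {x : A} {S : Set (J ⊕ A)} {p q : J ⊕ A} (hp : p ∈ I.best x S)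
    (hq : q ∈ I.best x S) : I.rk x p = I.rk x q :=
  le_antisymm (hp.2 q hq.1) (hq.2 p hp.1)

theorem inr_mem_jobList (x : A) : Sum.inr x ∈ I.jobList x := Or.inr rfl

theorem eq_of_inr_mem_jobList {x y : A} (h : Sum.inr x ∈ I.jobList y) : x = y := by
  rcases h with ⟨q, hq, _⟩ | h
  · exact absurd hq (by simp)
  · exact Sum.inr_injective h

variable [Fintype A]

/-! ### Weights and categories -/

theorem wt_lt_wt {i j : ℕ} (hi : 1 ≤ i) (hij : i < j) (hj : j ≤ I.k) : I.wt j < I.wt i := by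
  classical
  have hs : I.weights.Pairwise (· > ·) := by
    have := Finset.sortedGT_sort (Finset.univ.image I.weight)
    exact this.pairwise
  have h := List.pairwise_iff_getElem.1 hs (i - 1) (j - 1)
    (by unfold k at hj; omega) (by unfold k at hj; omega) (by omega)
  have hj' : j - 1 < I.weights.length := by unfold k at hj; omega
  have hi' : i - 1 < I.weights.length := by omega
  rw [wt, wt, List.getD_eq_getElem _ _ hj', List.getD_eq_getElem _ _ hi']
  exact h

theorem one_le_cat (x : A) : 1 ≤ I.cat x := by simp [cat]

theorem cat_le_k (x : A) : I.cat x ≤ I.k := by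
  classical
  have h : I.weight x ∈ I.weights := by simp [weights]
  have := List.idxOf_lt_length_iff.2 h
  simp only [cat, k]
  exact Nat.succ_le_of_lt (by convert this)

theorem wt_pos {i : ℕ} (hi : 1 ≤ i) (hk : i ≤ I.k) : 0 < I.wt i := by
  classical
  have hi' : i - 1 < I.weights.length := by unfold k at hk; omega
  have h : I.weights[i - 1] ∈ I.weights := List.getElem_mem hi'
  rw [wt, List.getD_eq_getElem _ _ hi']
  obtain ⟨x, hx⟩ : ∃ x, I.weight x = I.weights[i - 1] := by
    have h' := h
    simp only [weights, Finset.mem_sort, Finset.mem_image, Finset.mem_univ, true_and] at h'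
    exact h'
  exact hx ▸ I.weight_pos x

theorem wt_lt_weight_iff {i : ℕ} (hi : 1 ≤ i) (hk : i ≤ I.k) {x : A} :
    I.wt i < I.weight x ↔ I.cat x < i := by
  rw [← I.wt_cat x]
  constructor
  · intro h
    by_contra hlt
    rcases (not_lt.1 hlt).eq_or_lt with h' | h'
    · exact absurd h (by rw [h']; exact lt_irrefl _)
    · exact absurd h (I.wt_lt_wt hi h' (I.cat_le_k x)).not_gt
  · exact fun h => I.wt_lt_wt (I.one_le_cat x) h hk

theorem wt_le_weight_iff {i : ℕ} (hi : 1 ≤ i) (hk : i ≤ I.k) {x : A} :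
    I.wt i ≤ I.weight x ↔ I.cat x ≤ i := by
  rw [← I.wt_cat x]
  constructor
  · intro h
    by_contra hlt
    exact absurd h (I.wt_lt_wt hi (not_le.1 hlt) (I.cat_le_k x)).not_ge
  · intro h
    rcases h.eq_or_lt with h' | h'
    · rw [h']
    · exact (I.wt_lt_wt (I.one_le_cat x) h' hk).le

theorem weight_lt_weight_iff {x y : A} : I.weight x < I.weight y ↔ I.cat y < I.cat x := by
  rw [← I.wt_cat x, I.wt_lt_weight_iff (I.one_le_cat x) (I.cat_le_k x)]

/-! ### The graphs `G_i` and the first jobs -/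

theorem G_mono {i j : ℕ} (h : i ≤ j) : I.G i ⊆ I.G j := fun e he => by
  rw [mem_G_iff] at he ⊢
  exact ⟨he.1.trans h, he.2⟩

theorem mem_jobList_of_mem_first {x : A} {p : J ⊕ A} (hp : p ∈ I.first x) : p ∈ I.jobList x :=
  hp.1.1

theorem rk_eq_of_mem_first {x : A} {p q : J ⊕ A} (hp : p ∈ I.first x) (hq : q ∈ I.first x) :
    I.rk x p = I.rk x q :=
  I.rk_eq_of_mem_best hp hq

theorem G_subset_H (i : ℕ) : I.G i ⊆ I.H := fun e he =>
  I.mem_jobList_of_mem_first ((I.mem_G_iff i e).1 he).2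

theorem isMatching_inter_G (hM : IsMatching I.H M) (i : ℕ) : IsMatching (I.G i) (M ∩ I.G i) :=
  ⟨Set.inter_subset_right, fun e he e' he' => hM.2 e he.1 e' he'.1⟩

theorem G_zero : I.G 0 = ∅ := by
  ext e
  rw [mem_G_iff]
  have := I.one_le_cat e.1
  simp only [Set.mem_empty_iff_false, iff_false]
  omega

theorem criticalLeft_of_criticalRight_inr {i : ℕ} {x : A}
    (h : CriticalRight (I.G i) (Sum.inr x)) : CriticalLeft (I.G i) x := by
  intro M' hM
  obtain ⟨y, hy⟩ := h M' hM
  obtain rfl := I.eq_of_inr_mem_jobList (I.G_subset_H i (hM.1.1 hy))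
  exact ⟨_, hy⟩

/-- A job outside `f(x)` that `x` ranks as high as `f(x)` was skipped because it is critical in an
earlier graph. -/
theorem exists_critical_of_rk_le_first {x : A} {p q : J ⊕ A} (hp : p ∈ I.first x)
    (hq : q ∈ I.jobList x) (hqf : q ∉ I.first x) (hle : I.rk x q ≤ I.rk x p) :
    ∃ j < I.cat x, CriticalRight (I.G j) q := by
  by_contra! h
  exact hqf ⟨⟨hq, h⟩, fun r hr => hle.trans (hp.2 r hr)⟩

variable [Finite J]

theorem cat_le_of_criticalLeft {i : ℕ} {x : A} (h : CriticalLeft (I.G i) x) : I.cat x ≤ i := by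
  obtain ⟨M', hM⟩ := exists_isMaximum (I.G i)
  obtain ⟨p, hp⟩ := h M' hM
  exact ((I.mem_G_iff i _).1 (hM.1.1 hp)).1

theorem one_le_of_criticalRight {i : ℕ} {p : J ⊕ A} (h : CriticalRight (I.G i) p) : 1 ≤ i := by
  obtain ⟨M', hM⟩ := exists_isMaximum (I.G i)
  obtain ⟨x, hx⟩ := h M' hM
  exact (I.one_le_cat x).trans ((I.mem_G_iff i _).1 (hM.1.1 hx)).1

theorem best_nonempty {x : A} {S : Set (J ⊕ A)} (h : Sum.inr x ∈ S) : (I.best x S).Nonempty := by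
  obtain ⟨p, hp, hmin⟩ := Set.exists_min_image (I.jobList x ∩ S) (I.rk x) (Set.toFinite _)
    ⟨_, I.inr_mem_jobList x, h⟩
  exact ⟨p, hp, hmin⟩

/-- The last resort job of `x` is isolated in the graphs of the categories before `x`. -/
theorem first_nonempty (x : A) : (I.first x).Nonempty :=
  I.best_nonempty fun _ hj hc =>
    absurd (I.cat_le_of_criticalLeft (I.criticalLeft_of_criticalRight_inr hc)) hj.not_ge

end PrefInstance

/-! ### Potentials -/

/-- A simple path from `a` to `z` with vertex set `S` along the relation `r`, of total cost `v`. -/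
inductive SimplePath {V : Type*} (r : V → V → Prop) (c : V → V → ℝ) :
    V → V → Set V → ℝ → Prop
  | nil (a : V) : SimplePath r c a a {a} 0
  | cons {a b z : V} {S : Set V} {v : ℝ} (h : r a b) (ha : a ∉ S) (hb : SimplePath r c b z S v) :
      SimplePath r c a z (insert a S) (c a b + v)

namespace SimplePath

variable {V : Type*} {r : V → V → Prop} {c : V → V → ℝ} {a z : V} {S : Set V} {v : ℝ}

theorem target_mem (h : SimplePath r c a z S v) : z ∈ S := by
  induction h with
  | nil => rfl
  | cons _ _ _ ih => exact Or.inr ih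

theorem split (h : SimplePath r c a z S v) {b : V} (hb : b ∈ S) :
    ∃ S₁ v₁ S₂ v₂, SimplePath r c a b S₁ v₁ ∧ SimplePath r c b z S₂ v₂ ∧ v = v₁ + v₂ ∧
      S₁ ⊆ S := by
  induction h with
  | nil a =>
    obtain rfl : b = a := hb
    exact ⟨_, _, _, _, .nil b, .nil b, by simp, subset_rfl⟩
  | @cons a a' z S v h ha hp ih =>
    rcases hb with rfl | hb
    · exact ⟨_, _, _, _, .nil b, .cons h ha hp, by simp, by simp⟩
    · obtain ⟨S₁, v₁, S₂, v₂, h₁, h₂, hv, hS⟩ := ih hb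
      exact ⟨_, _, _, _, .cons h (fun h => ha (hS h)) h₁, h₂, by rw [hv]; ring,
        Set.insert_subset_insert hS⟩

/-- A simple path, closed up by an arc from its end to its start, is a cycle of a permutation that
fixes all other vertices. -/
theorem exists_perm [Fintype V] [DecidableEq V] (hr : ∀ a, r a a) (hc : ∀ a, c a a = 0)
    (h : SimplePath r c a z S v) :
    ∃ σ : Equiv.Perm V, σ z = a ∧ (∀ b, b ∉ S → σ b = b) ∧ (∀ b, b ≠ z → r b (σ b)) ∧
      ∑ b ∈ Finset.univ.erase z, c b (σ b) = v := by
  induction h with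
  | nil a => exact ⟨1, by simp, by simp, fun b _ => hr b, by simp [hc]⟩
  | @cons a' a z S v h ha hp ih =>
    obtain ⟨σ, hz, hfix, hσ, hsum⟩ := ih
    have ha' : σ a' = a' := hfix a' ha
    have haz : a' ≠ z := fun h => ha (h ▸ hp.target_mem)
    have h₁ : (Equiv.swap a' a * σ) a' = a := by simp [ha']
    have h₂ : ∀ b, b ≠ a' → b ≠ z → (Equiv.swap a' a * σ) b = σ b := fun b hb hbz => by
      rw [Equiv.Perm.mul_apply]
      exact Equiv.swap_apply_of_ne_of_ne (fun h => hb (σ.injective (h.trans ha'.symm)))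
        (fun h => hbz (σ.injective (h.trans hz.symm)))
    refine ⟨Equiv.swap a' a * σ, by simp [hz], fun b hb => ?_, fun b hb => ?_, ?_⟩
    · rw [h₂ b (fun h => hb (Or.inl h)) (fun h => hb (Or.inr (h ▸ hp.target_mem)))]
      exact hfix b fun h => hb (Or.inr h)
    · by_cases hba : b = a'
      · rw [hba, h₁]
        exact h
      · rw [h₂ b hba hb]
        exact hσ b hb
    · have : ∀ b ∈ Finset.univ.erase z, c b ((Equiv.swap a' a * σ) b) =
          (if b = a' then c a' a else 0) + c b (σ b) := by
        intro b hb
        by_cases hba : b = a'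
        · rw [hba, h₁, ha', hc]
          simp
        · rw [h₂ b hba (Finset.ne_of_mem_erase hb)]
          simp [hba]
      rw [Finset.sum_congr rfl this, Finset.sum_add_distrib, hsum, Finset.sum_ite_eq']
      simp [haz]

end SimplePath

/-- Shortest path potentials exist if no permutation along arcs has negative cost, and neither has a
permutation in which the arc at one vertex `z` is replaced by a terminal cost `τ` of `z`. -/
theorem exists_potential {V : Type*} [Fintype V] [DecidableEq V] {r : V → V → Prop}
    {c : V → V → ℝ} (hr : ∀ a, r a a) (hc : ∀ a, c a a = 0) {T : V → ℝ → Prop}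
    (hT : ∀ a, ∃ τ, T a τ)
    (h₁ : ∀ σ : Equiv.Perm V, (∀ a, r a (σ a)) → 0 ≤ ∑ a, c a (σ a))
    (h₂ : ∀ (σ : Equiv.Perm V) (z : V) (τ : ℝ), T z τ → (∀ a, a ≠ z → r a (σ a)) →
      0 ≤ τ + ∑ a ∈ Finset.univ.erase z, c a (σ a)) :
    ∃ γ : V → ℝ, (∀ a, 0 ≤ γ a) ∧ (∀ a τ, T a τ → γ a ≤ τ) ∧
      ∀ a b, r a b → γ a ≤ c a b + γ b := by
  let P : V → Set ℝ := fun a => {u | ∃ z S v τ, SimplePath r c a z S v ∧ T z τ ∧ u = v + τ}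
  have hP0 : ∀ a, ∀ u ∈ P a, 0 ≤ u := by
    rintro a _ ⟨z, S, v, τ, hp, hτ, rfl⟩
    obtain ⟨σ, -, -, hσ, rfl⟩ := hp.exists_perm hr hc
    rw [add_comm]
    exact h₂ σ z τ hτ hσ
  have hPb : ∀ a, BddBelow (P a) := fun a => ⟨0, fun u hu => hP0 a u hu⟩
  have hPn : ∀ a, (P a).Nonempty := fun a => by
    obtain ⟨τ, hτ⟩ := hT a
    exact ⟨_, a, _, _, τ, .nil a, hτ, rfl⟩
  refine ⟨fun a => sInf (P a), fun a => le_csInf (hPn a) (hP0 a), fun a τ hτ => ?_,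
    fun a b hab => ?_⟩
  · exact csInf_le (hPb a) ⟨a, _, _, τ, .nil a, hτ, (zero_add τ).symm⟩
  · rw [← sub_le_iff_le_add']
    refine le_csInf (hPn b) ?_
    rintro _ ⟨z, S, v, τ, hp, hτ, rfl⟩
    rw [sub_le_iff_le_add']
    by_cases ha : a ∈ S
    · -- The path from `b` already visits `a`: cut off the part before `a`, which closes up to a
      -- cycle of nonnegative cost.
      obtain ⟨S₁, v₁, S₂, v₂, hp₁, hp₂, rfl, -⟩ := hp.split ha
      obtain ⟨σ, hσa, -, hσ, rfl⟩ := hp₁.exists_perm hr hc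
      have hcyc := h₁ σ fun x => by
        by_cases hx : x = a
        · rw [hx, hσa]
          exact hab
        · exact hσ x hx
      rw [← Finset.add_sum_erase _ _ (Finset.mem_univ a), hσa] at hcyc
      have : sInf (P a) ≤ v₂ + τ := csInf_le (hPb a) ⟨z, S₂, v₂, τ, hp₂, hτ, rfl⟩
      linarith
    · exact csInf_le (hPb a) ⟨z, _, _, τ, .cons hab ha hp, hτ, by ring⟩

namespace PrefInstance

variable {A J : Type*} (I : PrefInstance A J) {M N : Set (A × (J ⊕ A))}

/-! ### Popularity certificates -/

/-- A feasible dual solution that certifies that a matching `M` that matches all applicants is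
popular. The value `β p` is the price of the job `p`: an applicant who trades its job in `M` for
another one pays at least its gain, and no applicant recovers more than its weight by giving up its
job. An inequality for worse jobs is not needed, as `nonneg` and `le_weight` imply it. -/
structure IsCertificate (M : Set (A × (J ⊕ A))) (β : J ⊕ A → ℝ) : Prop where
  nonneg : ∀ p, 0 ≤ β p
  eq_zero_of_free : ∀ p, (∀ x, (x, p) ∉ M) → β p = 0
  le_weight : ∀ x p, (x, p) ∈ M → β p ≤ I.weight x
  add_weight_le : ∀ x p q, (x, q) ∈ M → p ∈ I.jobList x → I.rk x p < I.rk x q →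
    β q + I.weight x ≤ β p
  le_of_rk_eq : ∀ x p q, (x, q) ∈ M → p ∈ I.jobList x → I.rk x p = I.rk x q → β q ≤ β p

variable {I} in
theorem IsCertificate.exists_mem {β : J ⊕ A → ℝ} (hβ : I.IsCertificate M β) {p : J ⊕ A}
    (hp : 0 < β p) : ∃ x, (x, p) ∈ M := by
  by_contra! h
  exact hp.ne' (hβ.eq_zero_of_free p h)

open Classical in
/-- The contribution of `x` to the satisfaction of `N` with respect to `M`. -/
noncomputable def gain (x : A) (N M : Set (A × (J ⊕ A))) : ℝ :=
  (if I.Prefers x N M then I.weight x else 0) - if I.Prefers x M N then I.weight x else 0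

theorem prefers_iff {x : A} {p q : J ⊕ A} (hM : IsMatching I.H M) (hN : IsMatching I.H N)
    (hp : (x, p) ∈ N) (hq : (x, q) ∈ M) : I.Prefers x N M ↔ I.rk x p < I.rk x q := by
  constructor
  · rintro ⟨p', hp', h⟩
    rw [hN.right_unique hp hp']
    exact h q hq
  · exact fun h => ⟨p, hp, fun q' hq' => hM.right_unique hq hq' ▸ h⟩

theorem gain_of_free {x : A} {q : J ⊕ A} (hq : (x, q) ∈ M) (hx : ∀ p, (x, p) ∉ N) :
    I.gain x N M = -I.weight x := by
  have h₁ : ¬ I.Prefers x N M := fun ⟨p, hp, _⟩ => hx p hp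
  have h₂ : I.Prefers x M N := ⟨q, hq, fun p hp => absurd hp (hx p)⟩
  simp [gain, h₁, h₂]

open Classical in
theorem gain_of_mem {x : A} {p q : J ⊕ A} (hM : IsMatching I.H M) (hN : IsMatching I.H N)
    (hp : (x, p) ∈ N) (hq : (x, q) ∈ M) : I.gain x N M =
      (if I.rk x p < I.rk x q then I.weight x else 0) -
        if I.rk x q < I.rk x p then I.weight x else 0 := by
  simp only [gain, I.prefers_iff hM hN hp hq, I.prefers_iff hN hM hq hp]

variable [Fintype A]

theorem satisfaction_eq_sum_gain : I.satisfaction N M = ∑ x, I.gain x N M := by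
  simp only [satisfaction, gain, Finset.sum_sub_distrib]

/-- Weak duality: the gains are bounded by differences of prices, and the jobs of `M` already have
the largest possible total price. -/
theorem popular_of_isCertificate [Fintype J] {β : J ⊕ A → ℝ} (hM : IsMatching I.H M)
    (hall : ∀ x, ∃ p, (x, p) ∈ M) (hβ : I.IsCertificate M β) : I.Popular M := by
  classical
  refine ⟨hM, ?_⟩
  rintro ⟨N, hN, hpos⟩
  have hgain : ∀ x, I.gain x N M ≤
      (∑ p, if (x, p) ∈ N then β p else 0) - ∑ p, if (x, p) ∈ M then β p else 0 := by
    intro x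
    obtain ⟨q, hq⟩ := hall x
    have hMs : (∑ p, if (x, p) ∈ M then β p else 0) = β q := by
      rw [Finset.sum_eq_single q (fun p _ hpq => if_neg fun hp => hpq (hM.right_unique hp hq))
        (fun h => absurd (Finset.mem_univ q) h), if_pos hq]
    rw [hMs]
    by_cases hx : ∃ p, (x, p) ∈ N
    · obtain ⟨p, hp⟩ := hx
      have hNs : (∑ p, if (x, p) ∈ N then β p else 0) = β p := by
        rw [Finset.sum_eq_single p (fun p' _ hpp => if_neg fun hp' => hpp (hN.right_unique hp' hp))
          (fun h => absurd (Finset.mem_univ p) h), if_pos hp]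
      rw [hNs, I.gain_of_mem hM hN hp hq]
      rcases lt_trichotomy (I.rk x p) (I.rk x q) with h | h | h
      · have := hβ.add_weight_le x p q hq (hN.1 hp) h
        simp only [h, if_true, h.not_gt, if_false]
        linarith
      · have := hβ.le_of_rk_eq x p q hq (hN.1 hp) h
        simp only [h, lt_irrefl, if_false]
        linarith
      · have h₁ := hβ.le_weight x q hq
        have h₂ := hβ.nonneg p
        simp only [h, if_true, h.not_gt, if_false]
        linarith
    · push Not at hx
      rw [I.gain_of_free hq hx]
      have := hβ.le_weight x q hq
      simp only [hx, if_false, Finset.sum_const_zero]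
      linarith
  have hNle : (∑ x, ∑ p, if (x, p) ∈ N then β p else 0) ≤ ∑ p, β p := by
    rw [Finset.sum_comm]
    refine Finset.sum_le_sum fun p _ => ?_
    by_cases hp : ∃ x, (x, p) ∈ N
    · obtain ⟨x, hx⟩ := hp
      rw [Finset.sum_eq_single x (fun y _ hyx => if_neg fun hy => hyx (hN.left_unique hy hx))
        (fun h => absurd (Finset.mem_univ x) h), if_pos hx]
    · push Not at hp
      simpa [hp] using hβ.nonneg p
  have hMeq : (∑ x, ∑ p, if (x, p) ∈ M then β p else 0) = ∑ p, β p := by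
    rw [Finset.sum_comm]
    refine Finset.sum_congr rfl fun p _ => ?_
    by_cases hp : ∃ x, (x, p) ∈ M
    · obtain ⟨x, hx⟩ := hp
      rw [Finset.sum_eq_single x (fun y _ hyx => if_neg fun hy => hyx (hM.left_unique hy hx))
        (fun h => absurd (Finset.mem_univ x) h), if_pos hx]
    · push Not at hp
      simp [hp, hβ.eq_zero_of_free p hp]
  have h := Finset.sum_le_sum fun x (_ : x ∈ Finset.univ) => hgain x
  rw [Finset.sum_sub_distrib, hMeq, ← satisfaction_eq_sum_gain] at h
  linarith

theorem Popular.exists_mem {I : PrefInstance A J} (hM : I.Popular M) (x : A) :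
    ∃ p, (x, p) ∈ M := by
  classical
  by_contra hx
  push Not at hx
  have hfree : ∀ y, (y, Sum.inr x) ∉ M := fun y hy => by
    obtain rfl := I.eq_of_inr_mem_jobList (hM.1.1 hy)
    exact hx _ hy
  have hN : IsMatching I.H (insert (x, Sum.inr x) M) := by
    constructor
    · rintro e (rfl | he)
      · exact I.inr_mem_jobList x
      · exact hM.1.1 he
    · have key : ∀ e ∈ M, ¬ (x = e.1 ∨ Sum.inr x = e.2) := by
        rintro ⟨y, p⟩ he (h | h)
        · exact hx p (by rw [show x = y from h]; exact he)
        · exact hfree y (by rw [show Sum.inr x = p from h]; exact he)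
      rintro e (rfl | he) e' (rfl | he') h
      · rfl
      · exact absurd h (key e' he')
      · exact absurd (h.imp Eq.symm Eq.symm) (key e he)
      · exact hM.1.2 e he e' he' h
  refine hM.2 ⟨_, hN, ?_⟩
  rw [satisfaction_eq_sum_gain, Finset.sum_eq_single x]
  · have h₁ : I.Prefers x (insert (x, Sum.inr x) M) M :=
      ⟨_, Set.mem_insert _ _, fun q hq => absurd hq (hx q)⟩
    have h₂ : ¬ I.Prefers x M (insert (x, Sum.inr x) M) := fun ⟨p, hp, _⟩ => hx p hp
    simpa [gain, h₁, h₂] using I.weight_pos x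
  · intro y _ hyx
    have : ∀ p, (y, p) ∈ insert (x, Sum.inr x) M ↔ (y, p) ∈ M := fun p => by
      simp [hyx]
    simp [gain, Prefers, this]
  · simp

theorem Popular.sum_gain_nonpos {I : PrefInstance A J} (hM : I.Popular M)
    (hN : IsMatching I.H N) : ∑ x, I.gain x N M ≤ 0 := by
  rw [← satisfaction_eq_sum_gain]
  exact not_lt.1 fun h => hM.2 ⟨N, hN, h⟩

/-- Certificates for a popular matching are shortest path potentials on the applicants: an arc leads
from `a` to `b` if `a` may take over the job of `b` without a loss, and its cost is the loss of `a`;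
a path ends where an applicant takes a free job or gives up its job. -/
theorem Popular.exists_isCertificate {I : PrefInstance A J} (hM : I.Popular M) :
    ∃ β, I.IsCertificate M β := by
  classical
  choose m hm using hM.exists_mem
  have hm_inj : Function.Injective m := fun a b h => hM.1.left_unique (hm a) (h ▸ hm b)
  have hm_eq : ∀ {x p}, (x, p) ∈ M → p = m x := fun h => hM.1.right_unique h (hm _)
  let g : A → J ⊕ A → ℝ := fun a p => if I.rk a p < I.rk a (m a) then I.weight a else 0
  have hgain : ∀ {N a p}, IsMatching I.H N → (a, p) ∈ N → I.rk a p ≤ I.rk a (m a) →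
      I.gain a N M = g a p := by
    intro N a p hN hp hle
    rw [I.gain_of_mem hM.1 hN hp (hm a), if_neg hle.not_gt, sub_zero]
  obtain ⟨γ, h0, hT, hr⟩ := exists_potential
    (r := fun a b => m b ∈ I.jobList a ∧ I.rk a (m b) ≤ I.rk a (m a))
    (c := fun a b => -g a (m b))
    (T := fun a τ => τ = I.weight a ∨
      ∃ p, (∀ x, (x, p) ∉ M) ∧ p ∈ I.jobList a ∧ I.rk a p ≤ I.rk a (m a) ∧ τ = -g a p)
    (fun a => ⟨hM.1.1 (hm a), le_rfl⟩) (fun a => by simp [g]) (fun a => ⟨_, Or.inl rfl⟩)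
    (by
      intro σ hσ
      have hN : IsMatching I.H {e : A × (J ⊕ A) | e.2 = m (σ e.1)} := by
        refine ⟨fun e he => ?_, ?_⟩
        · show e.2 ∈ I.jobList e.1
          rw [show e.2 = _ from he]
          exact (hσ e.1).1
        · rintro ⟨a, p⟩ he ⟨b, q⟩ he' h
          have he : p = m (σ a) := he
          have he' : q = m (σ b) := he'
          simp only at h
          have : a = b := h.elim id fun h => σ.injective (hm_inj (he ▸ he' ▸ h))
          subst this
          rw [he, he']
      have h := hM.sum_gain_nonpos hN
      rw [Finset.sum_congr rfl fun a _ => hgain hN (show (a, m (σ a)) ∈ _ from rfl) (hσ a).2] at h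
      rw [Finset.sum_neg_distrib]
      linarith)
    (by
      intro σ z τ hτ hσ
      have hsub : ∀ S : Set (J ⊕ A), S.Subsingleton → (∀ p ∈ S, p ∈ I.jobList z) →
          (∀ p ∈ S, ∀ x, (x, p) ∉ M) →
          IsMatching I.H {e : A × (J ⊕ A) | (e.1 ≠ z ∧ e.2 = m (σ e.1)) ∨ (e.1 = z ∧ e.2 ∈ S)} := by
        intro S hS hSl hSf
        refine ⟨fun e he => ?_, ?_⟩
        · show e.2 ∈ I.jobList e.1
          rcases he with ⟨h, he⟩ | ⟨h, he⟩
          · rw [he]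
            exact (hσ e.1 h).1
          · rw [h]
            exact hSl _ he
        · rintro ⟨a, p⟩ (⟨ha, hp⟩ | ⟨ha, hp⟩) ⟨b, q⟩ (⟨hb, hq⟩ | ⟨hb, hq⟩) h <;>
            simp only at ha hp hb hq h
          · have : a = b := h.elim id fun h => σ.injective (hm_inj (hp ▸ hq ▸ h))
            subst this
            rw [hp, hq]
          · rcases h with h | h
            · exact absurd (h.trans hb) ha
            · exact absurd (hm (σ a)) (by rw [← hp, h]; exact hSf q hq _)
          · rcases h with h | h
            · exact absurd (h.symm.trans ha) hb
            · exact absurd (hm (σ b)) (by rw [← hq, ← h]; exact hSf p hp _)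
          · rw [ha, hb, hS hp hq]
      have hkey : ∀ N, IsMatching I.H N → (∀ a, a ≠ z → (a, m (σ a)) ∈ N) →
          I.gain z N M + ∑ a ∈ Finset.univ.erase z, g a (m (σ a)) ≤ 0 := by
        intro N hN hNσ
        have h := hM.sum_gain_nonpos hN
        rw [← Finset.add_sum_erase _ _ (Finset.mem_univ z)] at h
        rwa [Finset.sum_congr rfl fun a ha => hgain hN (hNσ a (Finset.ne_of_mem_erase ha))
          (hσ a (Finset.ne_of_mem_erase ha)).2] at h
      rw [Finset.sum_neg_distrib]
      rcases hτ with rfl | ⟨p, hpf, hpl, hple, rfl⟩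
      · have h := hkey _ (hsub ∅ Set.subsingleton_empty (by simp) (by simp))
          fun a ha => Or.inl ⟨ha, rfl⟩
        rw [I.gain_of_free (hm z) (by simp)] at h
        linarith
      · have hN := hsub {p} Set.subsingleton_singleton (by simpa using hpl) (by simpa using hpf)
        have h := hkey _ hN fun a ha => Or.inl ⟨ha, rfl⟩
        rw [hgain hN (Or.inr ⟨rfl, rfl⟩) hple] at h
        linarith)
  let β : J ⊕ A → ℝ := fun p => if h : ∃ x, (x, p) ∈ M then γ h.choose else 0
  have hβm : ∀ a, β (m a) = γ a := fun a => by
    have h : ∃ x, (x, m a) ∈ M := ⟨a, hm a⟩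
    simp only [β, dif_pos h]
    rw [hM.1.left_unique h.choose_spec (hm a)]
  have hβf : ∀ p, (∀ x, (x, p) ∉ M) → β p = 0 := fun p hp => dif_neg (by simpa using hp)
  refine ⟨β, ⟨fun p => ?_, hβf, fun x p hp => ?_, fun x p q hq hp hlt => ?_,
    fun x p q hq hp heq => ?_⟩⟩
  · by_cases h : ∃ x, (x, p) ∈ M
    · simp only [β, dif_pos h]
      exact h0 _
    · simp only [β, dif_neg h, le_refl]
  · rw [hm_eq hp, hβm]
    exact hT x _ (Or.inl rfl)
  · obtain rfl := hm_eq hq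
    have hg : g x p = I.weight x := if_pos hlt
    rw [hβm]
    by_cases h : ∃ y, (y, p) ∈ M
    · obtain ⟨y, hy⟩ := h
      obtain rfl := hm_eq hy
      have := hr x y ⟨hp, hlt.le⟩
      rw [hg] at this
      rw [hβm]
      linarith
    · push Not at h
      rw [hβf p h]
      have := hT x _ (Or.inr ⟨p, h, hp, hlt.le, rfl⟩)
      rw [hg] at this
      linarith
  · obtain rfl := hm_eq hq
    have hg : g x p = 0 := if_neg heq.not_lt
    rw [hβm]
    by_cases h : ∃ y, (y, p) ∈ M
    · obtain ⟨y, hy⟩ := h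
      obtain rfl := hm_eq hy
      have := hr x y ⟨hp, heq.le⟩
      rw [hg] at this
      rw [hβm]
      linarith
    · push Not at h
      rw [hβf p h]
      have := hT x _ (Or.inr ⟨p, h, hp, heq.le, rfl⟩)
      rw [hg] at this
      linarith

end PrefInstance

namespace PrefInstance

variable {A J : Type*} [Fintype A] (I : PrefInstance A J)

/-! ### The labels computed by the procedure -/

theorem exists_first_critical {p : J ⊕ A} {j : ℕ} (h : CriticalRight (I.G j) p) :
    ∃ i ≤ j, CriticalRight (I.G i) p ∧ ∀ l < i, ¬ CriticalRight (I.G l) p := by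
  classical
  have hex : ∃ i, CriticalRight (I.G i) p := ⟨j, h⟩
  exact ⟨Nat.find hex, Nat.find_min' hex h, Nat.find_spec hex, fun l hl => Nat.find_min hex hl⟩

theorem lamEquiv_congr {lab lab' : J ⊕ A → EReal} {x : A}
    (h : ∀ p, ∀ j < I.cat x, CriticalRight (I.G j) p → lab p = lab' p) :
    I.lamEquiv lab x = I.lamEquiv lab' x :=
  iInf_congr fun q => iInf_congr fun hq => by
    obtain ⟨p, hp, hr⟩ := hq.2.2
    obtain ⟨j, hj, hc⟩ := I.exists_critical_of_rk_le_first hp hq.1 hq.2.1 hr.le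
    exact h q j hj hc

theorem exists_lt_of_pruneStep_eq_none {i : ℕ} {N : Set (A × (J ⊕ A))} {s : PruneState A J}
    (h : I.pruneStep i N s = none) :
    ∃ x, I.cat x = i ∧ I.lamMin s.lab x (I.first x) < (I.wt i : EReal) := by
  unfold PrefInstance.pruneStep at h
  split_ifs at h with h'
  exact h'

variable [Finite J]

theorem exists_critical_of_lt_first {x : A} {q : J ⊕ A} (hq : q ∈ I.jobList x)
    (h : ∀ p ∈ I.first x, I.rk x q < I.rk x p) : ∃ j < I.cat x, CriticalRight (I.G j) q := by
  obtain ⟨p, hp⟩ := I.first_nonempty x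
  exact I.exists_critical_of_rk_le_first hp hq (fun hqf => lt_irrefl _ (h q hqf)) (h p hp).le

/-- `λ_min(x, f(x))` depends only on the labels of jobs that are critical before the category of
`x`. -/
theorem lamMin_first_congr {lab lab' : J ⊕ A → EReal} {x : A}
    (h : ∀ p, ∀ j < I.cat x, CriticalRight (I.G j) p → lab p = lab' p) :
    I.lamMin lab x (I.first x) = I.lamMin lab' x (I.first x) :=
  iInf_congr fun q => iInf_congr fun hq => by
    obtain ⟨j, hj, hc⟩ := I.exists_critical_of_lt_first hq.1 hq.2
    exact h q j hj hc

/-- What holds after iteration `m` of `prune-ties`: labels and pruned edges are described by the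
current labels, since labels that have been assigned never change. In contrast to the procedure,
the description is the same for the first iteration and for the later ones: for applicants of the
first category, `λ_min` and `λ_equiv` are infinite. -/
structure PruneInv (N : ℕ → Set (A × (J ⊕ A))) (m : ℕ) (s : PruneState A J) : Prop where
  lab_eq : ∀ i p, i ≤ m → CriticalRight (I.G i) p → (∀ j < i, ¬ CriticalRight (I.G j) p) →
    s.lab p = min (I.wt i : EReal)
      (⨅ x ∈ {x | CriticalLeft (I.G i) x ∧ AltPath (I.G i) (N i) p x},
        min (I.lamMin s.lab x (I.first x) - (I.weight x : EReal)) (I.lamEquiv s.lab x))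
  le_lamMin : ∀ x, I.cat x ≤ m → (I.weight x : EReal) ≤ I.lamMin s.lab x (I.first x)
  mem_edges : ∀ e, e ∈ s.edges ↔ e.2 ∈ I.first e.1 ∪ I.second e.1 ∧
    ∀ i ≤ m, I.cat e.1 ≤ i → ¬ CriticalLeft (I.G i) e.1 → e.2 ∈ I.first e.1 →
      ((I.weight e.1 + I.wt i : ℝ) : EReal) ≤ I.lamMin s.lab e.1 (I.first e.1) ∧
        (I.wt i : EReal) ≤ I.lamEquiv s.lab e.1

theorem lamMin_eq_top {lab : J ⊕ A → EReal} {x : A} (hx : I.cat x ≤ 1) :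
    I.lamMin lab x (I.first x) = ⊤ := by
  refine iInf₂_eq_top.2 fun q hq => ?_
  obtain ⟨j, hj, hc⟩ := I.exists_critical_of_lt_first hq.1 hq.2
  have := I.one_le_of_criticalRight hc
  omega

theorem lamEquiv_eq_top {lab : J ⊕ A → EReal} {x : A} (hx : I.cat x ≤ 1) :
    I.lamEquiv lab x = ⊤ := by
  refine iInf₂_eq_top.2 fun q hq => ?_
  obtain ⟨p, hp, hr⟩ := hq.2.2
  obtain ⟨j, hj, hc⟩ := I.exists_critical_of_rk_le_first hp hq.1 hq.2.1 hr.le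
  have := I.one_le_of_criticalRight hc
  omega

theorem pruneInv_pruneInit (N : ℕ → Set (A × (J ⊕ A))) : I.PruneInv N 1 I.pruneInit where
  lab_eq i p hi hc _ := by
    obtain rfl : i = 1 := le_antisymm hi (I.one_le_of_criticalRight hc)
    simp only [pruneInit, if_pos hc]
    refine (min_eq_left (le_iInf₂ fun x hx => ?_)).symm
    have hcat := I.cat_le_of_criticalLeft hx.1
    rw [I.lamMin_eq_top hcat, I.lamEquiv_eq_top hcat, EReal.top_sub_coe]
    simp
  le_lamMin x hx := by
    rw [I.lamMin_eq_top hx]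
    exact le_top
  mem_edges e := by
    refine ⟨fun h => ⟨h, fun i hi hcat _ _ => ?_⟩, fun h => h.1⟩
    rw [I.lamMin_eq_top (hcat.trans hi), I.lamEquiv_eq_top (hcat.trans hi)]
    exact ⟨le_top, le_top⟩

theorem PruneInv.pruneStep {I : PrefInstance A J} {N : ℕ → Set (A × (J ⊕ A))} {m : ℕ}
    {s s' : PruneState A J} (h : I.PruneInv N m s)
    (hs : I.pruneStep (m + 1) (N (m + 1)) s = some s') : I.PruneInv N (m + 1) s' := by
  classical
  unfold PrefInstance.pruneStep at hs
  split_ifs at hs with hearly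
  have hs := Option.some_injective _ hs
  have hlab : ∀ p, s'.lab p =
      if CriticalRight (I.G (m + 1)) p ∧ ∀ j < m + 1, ¬ CriticalRight (I.G j) p then
        min (I.wt (m + 1) : EReal)
          (⨅ x ∈ {x | CriticalLeft (I.G (m + 1)) x ∧ AltPath (I.G (m + 1)) (N (m + 1)) p x},
            min (I.lamMin s.lab x (I.first x) - (I.weight x : EReal)) (I.lamEquiv s.lab x))
      else s.lab p := fun p => by rw [← hs]
  push Not at hearly
  have hagree : ∀ p j, j ≤ m → CriticalRight (I.G j) p → s.lab p = s'.lab p := fun p j hj hc => by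
    have : ¬ (CriticalRight (I.G (m + 1)) p ∧ ∀ j < m + 1, ¬ CriticalRight (I.G j) p) :=
      fun h => h.2 j (by omega) hc
    rw [hlab, if_neg this]
  have hmin : ∀ x, I.cat x ≤ m + 1 →
      I.lamMin s.lab x (I.first x) = I.lamMin s'.lab x (I.first x) := fun x hx =>
    I.lamMin_first_congr fun p j hj => hagree p j (by omega)
  have heq : ∀ x, I.cat x ≤ m + 1 → I.lamEquiv s.lab x = I.lamEquiv s'.lab x := fun x hx =>
    I.lamEquiv_congr fun p j hj => hagree p j (by omega)
  refine ⟨fun i p hi hc hnc => ?_, fun x hx => ?_, fun e => ?_⟩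
  · have hinf : (⨅ x ∈ {x | CriticalLeft (I.G i) x ∧ AltPath (I.G i) (N i) p x},
        min (I.lamMin s.lab x (I.first x) - (I.weight x : EReal)) (I.lamEquiv s.lab x)) =
        ⨅ x ∈ {x | CriticalLeft (I.G i) x ∧ AltPath (I.G i) (N i) p x},
        min (I.lamMin s'.lab x (I.first x) - (I.weight x : EReal)) (I.lamEquiv s'.lab x) :=
      iInf_congr fun x => iInf_congr fun hx => by
        have hcat := (I.cat_le_of_criticalLeft hx.1).trans hi
        rw [hmin x hcat, heq x hcat]
    rw [← hinf]
    rcases hi.eq_or_lt with rfl | hi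
    · rw [hlab, if_pos ⟨hc, hnc⟩]
    · rw [← hagree p i (by omega) hc]
      exact h.lab_eq i p (by omega) hc hnc
  · rw [← hmin x hx]
    rcases hx.eq_or_lt with hx | hx
    · rw [← I.wt_cat, hx]
      exact hearly x hx
    · exact h.le_lamMin x (by omega)
  · have hmem : e ∈ s'.edges ↔ e ∈ s.edges ∧ ¬ (I.cat e.1 ≤ m + 1 ∧
        ¬ CriticalLeft (I.G (m + 1)) e.1 ∧ e.2 ∈ I.first e.1 ∧
        (I.lamMin s.lab e.1 (I.first e.1) < ((I.weight e.1 + I.wt (m + 1) : ℝ) : EReal) ∨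
          I.lamEquiv s.lab e.1 < (I.wt (m + 1) : EReal))) := by
      rw [← hs]
      exact Iff.rfl
    rw [hmem, h.mem_edges e, and_assoc]
    refine and_congr_right fun _ => ?_
    constructor
    · rintro ⟨h₁, h₂⟩ i hi hcat hnc hf
      rw [← hmin _ (hcat.trans hi), ← heq _ (hcat.trans hi)]
      rcases hi.eq_or_lt with rfl | hi
      · by_contra hlt
        rw [not_and_or, not_le, not_le] at hlt
        exact h₂ ⟨hcat, hnc, hf, hlt⟩
      · exact h₁ i (by omega) hcat hnc hf
    · intro h'
      refine ⟨fun i hi hcat hnc hf => ?_, ?_⟩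
      · rw [hmin _ (by omega), heq _ (by omega)]
        exact h' i (by omega) hcat hnc hf
      · rintro ⟨hcat, hnc, hf, hlt⟩
        have := h' (m + 1) le_rfl hcat hnc hf
        rw [← hmin _ hcat, ← heq _ hcat] at this
        exact hlt.elim this.1.not_gt this.2.not_gt

theorem pruneInv_of_foldlM (N : ℕ → Set (A × (J ⊕ A))) (n : ℕ) :
    (∀ s, (List.range' 2 n).foldlM (fun s i => I.pruneStep i (N i) s) I.pruneInit = some s →
      I.PruneInv N (n + 1) s) ∧
    ((List.range' 2 n).foldlM (fun s i => I.pruneStep i (N i) s) I.pruneInit = none →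
      ∃ m s, 1 ≤ m ∧ m ≤ n ∧ I.PruneInv N m s ∧ I.pruneStep (m + 1) (N (m + 1)) s = none) := by
  induction n with
  | zero =>
    refine ⟨fun s hs => ?_, fun hs => by simp at hs⟩
    obtain rfl : I.pruneInit = s := by simpa using hs
    exact I.pruneInv_pruneInit N
  | succ n ih =>
    rw [List.range'_1_concat, List.foldlM_append]
    cases hfold : (List.range' 2 n).foldlM (fun s i => I.pruneStep i (N i) s) I.pruneInit with
    | none =>
      obtain ⟨m, s, h₁, h₂, h₃⟩ := ih.2 hfold
      exact ⟨by simp, fun _ => ⟨m, s, h₁, by omega, h₃⟩⟩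
    | some s =>
      have hinv := ih.1 s hfold
      have h2 : 2 + n = n + 1 + 1 := by omega
      rw [h2]
      refine ⟨fun s' hs' => hinv.pruneStep (by simpa using hs'), fun h => ?_⟩
      exact ⟨n + 1, s, by omega, le_rfl, hinv, by simpa using h⟩

end PrefInstance

namespace PrefInstance

variable {A J : Type*} [Fintype A] {I : PrefInstance A J} {M : Set (A × (J ⊕ A))}

/-! ### Popular matchings are well-formed -/

theorem mem_inter_G {i : ℕ} {x : A} {p : J ⊕ A} :
    (x, p) ∈ M ∩ I.G i ↔ (x, p) ∈ M ∧ I.cat x ≤ i ∧ p ∈ I.first x := by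
  rw [Set.mem_inter_iff, mem_G_iff]

theorem isMaximum_inter_G_zero (hM : IsMatching I.H M) : IsMaximum (I.G 0) (M ∩ I.G 0) := by
  refine ⟨I.isMatching_inter_G hM 0, fun N hN => ?_⟩
  have : N = ∅ := Set.subset_eq_empty hN.1 I.G_zero
  simp [this]

/-- An applicant that is not matched to a first job is matched to a job that it ranks worse. -/
theorem rk_lt_of_notMem_first (hM : IsMatching I.H M) {x : A} {p q : J ⊕ A}
    (hmax : ∀ j < I.cat x, IsMaximum (I.G j) (M ∩ I.G j)) (hq : (x, q) ∈ M) (hqf : q ∉ I.first x)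
    (hp : p ∈ I.first x) : I.rk x p < I.rk x q := by
  by_contra! h
  obtain ⟨j, hj, hc⟩ := I.exists_critical_of_rk_le_first hp (hM.1 hq) hqf h
  obtain ⟨y, hy⟩ := hc _ (hmax j hj)
  obtain rfl := hM.left_unique hy.1 hq
  exact hqf (mem_inter_G.1 hy).2.2

section Certificate

variable {β : J ⊕ A → ℝ}

theorem IsCertificate.le_of_mem_inter_G (hβ : I.IsCertificate M β) {i : ℕ} {x : A} {p q : J ⊕ A}
    (hq : (x, q) ∈ M ∩ I.G i) (hp : (x, p) ∈ I.G i) : β q ≤ β p :=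
  hβ.le_of_rk_eq x p q hq.1 (I.G_subset_H i hp)
    (I.rk_eq_of_mem_first ((I.mem_G_iff i _).1 hp).2 (mem_inter_G.1 hq).2.2)

theorem IsCertificate.le_of_reach (hβ : I.IsCertificate M β) {i : ℕ} {p q : J ⊕ A}
    (h : Relation.ReflTransGen (Step (I.G i) (M ∩ I.G i)) p q) : β p ≤ β q := by
  induction h with
  | refl => exact le_rfl
  | tail _ h ih =>
    obtain ⟨a, h₁, h₂⟩ := h
    exact ih.trans (hβ.le_of_mem_inter_G h₁ h₂)

/-- Jobs of value at least `b` that are matched to first jobs within `G_i` are critical in `G_i`. -/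
theorem IsCertificate.criticalRight [Finite J] (hM : IsMatching I.H M)
    (hβ : I.IsCertificate M β) {i : ℕ} {b : ℝ}
    (h : ∀ q, b ≤ β q → ∃ x, (x, q) ∈ M ∩ I.G i) {p : J ⊕ A} (hp : b ≤ β p) :
    CriticalRight (I.G i) p :=
  criticalRight_of_closed (R := {q | b ≤ β q}) (I.isMatching_inter_G hM i) h
    (fun _ _ _ hq h₁ h₂ => le_trans hq (hβ.le_of_mem_inter_G h₁ h₂)) hp

/-- Jobs of positive value are first jobs of their applicants. For a counterexample `(y, p)` of
largest value, the first jobs of `y` have an even larger value, so they are matched to applicants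
with a weight larger than that of `y`. The jobs of at least this value are then all matched within
the graph of an earlier category, so they are critical there, and are no first jobs of `y`. -/
theorem IsCertificate.mem_first_of_pos [Finite J] (hM : IsMatching I.H M)
    (hβ : I.IsCertificate M β) {i : ℕ} (hmax : ∀ j < i, IsMaximum (I.G j) (M ∩ I.G j)) {y : A}
    {p : J ⊕ A} (hy : I.cat y ≤ i) (hp : (y, p) ∈ M) (hpos : 0 < β p) : p ∈ I.first y := by
  by_contra hpf
  obtain ⟨⟨y, p⟩, ⟨hp, hy, hpf, hpos⟩, hbig⟩ := Set.exists_max_image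
    {e : A × (J ⊕ A) | e ∈ M ∧ I.cat e.1 ≤ i ∧ e.2 ∉ I.first e.1 ∧ 0 < β e.2} (fun e => β e.2)
    (Set.toFinite _) ⟨(y, p), hp, hy, hpf, hpos⟩
  simp only at hp hy hpf hpos hbig
  obtain ⟨p', hp'⟩ := I.first_nonempty y
  have hval : β p + I.weight y ≤ β p' := hβ.add_weight_le y p' p hp
    (I.mem_jobList_of_mem_first hp')
    (rk_lt_of_notMem_first hM (fun j hj => hmax j (by omega)) hp hpf hp')
  have hwy := I.weight_pos y
  have hmatched : ∀ q, β p' ≤ β q → ∃ z, (z, q) ∈ M ∩ I.G (I.cat y - 1) := by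
    intro q hq
    obtain ⟨z, hz⟩ := hβ.exists_mem (p := q) (by linarith)
    have hcat : I.cat z < I.cat y := I.weight_lt_weight_iff.1 (by
      have := hβ.le_weight z q hz
      linarith)
    refine ⟨z, mem_inter_G.2 ⟨hz, by omega, ?_⟩⟩
    by_contra hqf
    have := hbig (z, q) ⟨hz, by simp only; omega, hqf, by simp only; linarith⟩
    simp only at this
    linarith
  have hcrit := hβ.criticalRight hM hmatched (p := p') le_rfl
  have := I.one_le_cat y
  exact hp'.1.2 (I.cat y - 1) (by omega) hcrit

theorem IsCertificate.exists_mem_inter_G [Finite J] (hM : IsMatching I.H M)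
    (hβ : I.IsCertificate M β) {i : ℕ} (hmax : ∀ j < i, IsMaximum (I.G j) (M ∩ I.G j))
    (hi : 1 ≤ i) (hk : i ≤ I.k) {p : J ⊕ A} (hp : I.wt i ≤ β p) : ∃ x, (x, p) ∈ M ∩ I.G i := by
  have hpos := (I.wt_pos hi hk).trans_le hp
  obtain ⟨x, hx⟩ := hβ.exists_mem hpos
  have hcat := (I.wt_le_weight_iff hi hk).1 (hp.trans (hβ.le_weight x p hx))
  exact ⟨x, mem_inter_G.2 ⟨hx, hcat, hβ.mem_first_of_pos hM hmax hcat hx hpos⟩⟩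

/-- The first jobs of an applicant that is matched to none of them have at least its weight as
value. -/
theorem IsCertificate.weight_le_of_notMem_first (hM : IsMatching I.H M)
    (hall : ∀ x, ∃ p, (x, p) ∈ M) (hβ : I.IsCertificate M β) {x : A}
    (hmax : ∀ j < I.cat x, IsMaximum (I.G j) (M ∩ I.G j)) (hx : ∀ p, p ∈ I.first x → (x, p) ∉ M)
    {p : J ⊕ A} (hp : p ∈ I.first x) : I.weight x ≤ β p := by
  obtain ⟨q, hq⟩ := hall x
  have := hβ.add_weight_le x p q hq (I.mem_jobList_of_mem_first hp)
    (rk_lt_of_notMem_first hM hmax hq (fun h => hx q h hq) hp)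
  linarith [hβ.nonneg q]

/-- The jobs of value at least `w_i` satisfy König's criterion in `G_i`. -/
theorem IsCertificate.isMaximum [Finite J] (hM : IsMatching I.H M) (hall : ∀ x, ∃ p, (x, p) ∈ M)
    (hβ : I.IsCertificate M β) (i : ℕ) (hk : i ≤ I.k) : IsMaximum (I.G i) (M ∩ I.G i) := by
  induction i using Nat.strong_induction_on with
  | _ i ih =>
    rcases Nat.eq_zero_or_pos i with rfl | hi
    · exact isMaximum_inter_G_zero hM
    have hmax : ∀ j < i, IsMaximum (I.G j) (M ∩ I.G j) := fun j hj => ih j hj (by omega)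
    refine isMaximum_of_closed (R := {q | I.wt i ≤ β q}) (I.isMatching_inter_G hM i)
      (fun p hp => hβ.exists_mem_inter_G hM hmax hi hk hp)
      (fun a p p' hp h₁ h₂ => le_trans hp (hβ.le_of_mem_inter_G h₁ h₂)) fun x p hp hx => ?_
    rw [mem_G_iff] at hp
    refine ((I.wt_le_weight_iff hi hk).2 hp.1).trans
      (hβ.weight_le_of_notMem_first hM hall (fun j hj => hmax j (hj.trans_le hp.1)) ?_ hp.2)
    exact fun p' hp' hxp' => hx p' (mem_inter_G.2 ⟨hxp', hp.1, hp'⟩)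

theorem IsCertificate.criticalRight_of_wt_le [Finite J] (hM : IsMatching I.H M)
    (hall : ∀ x, ∃ p, (x, p) ∈ M) (hβ : I.IsCertificate M β) {i : ℕ} (hi : 1 ≤ i) (hk : i ≤ I.k)
    {p : J ⊕ A} (hp : I.wt i ≤ β p) : CriticalRight (I.G i) p :=
  hβ.criticalRight hM (fun _ hq => hβ.exists_mem_inter_G hM
    (fun j hj => hβ.isMaximum hM hall j (by omega)) hi hk hq) hp

theorem IsCertificate.mem_second [Finite J] (hM : IsMatching I.H M)
    (hall : ∀ x, ∃ p, (x, p) ∈ M) (hβ : I.IsCertificate M β) {x : A} {q : J ⊕ A}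
    (hq : (x, q) ∈ M) (hqf : q ∉ I.first x) : q ∈ I.second x := by
  have hk := I.cat_le_k x
  have hmax : ∀ j ≤ I.cat x, IsMaximum (I.G j) (M ∩ I.G j) := fun j hj =>
    hβ.isMaximum hM hall j (hj.trans hk)
  refine ⟨fun h => ?_, ⟨⟨hM.1 hq, fun j hj h => ?_⟩, fun p hp => ?_⟩⟩
  · obtain ⟨p, hp⟩ := h _ (hmax _ le_rfl)
    rw [mem_inter_G] at hp
    exact hqf (hM.right_unique hp.1 hq ▸ hp.2.2)
  · obtain ⟨y, hy⟩ := h _ (hmax j hj)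
    obtain rfl := hM.left_unique hy.1 hq
    exact hqf (mem_inter_G.1 hy).2.2
  · by_contra! hlt
    refine hp.2 (I.cat x) le_rfl
      (hβ.criticalRight_of_wt_le hM hall (I.one_le_cat x) hk ?_)
    rw [I.wt_cat]
    linarith [hβ.add_weight_le x p q hq hp.1 hlt, hβ.nonneg q]

theorem IsCertificate.wellFormed [Finite J] (hM : IsMatching I.H M)
    (hall : ∀ x, ∃ p, (x, p) ∈ M) (hβ : I.IsCertificate M β) : I.WellFormed M := by
  refine ⟨hM, fun i _ hk => hβ.isMaximum hM hall i hk, fun x => ?_⟩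
  obtain ⟨q, hq⟩ := hall x
  by_cases hqf : q ∈ I.first x
  · exact ⟨q, hq, Or.inl hqf⟩
  · exact ⟨q, hq, Or.inr (hβ.mem_second hM hall hq hqf)⟩

/-! ### Labels bound the values of a certificate -/

/-- A job that becomes critical in `G_i` has at most the value `w_i`: the jobs of larger value are
matched within `G_{i-1}`, and critical there. -/
theorem IsCertificate.le_wt [Finite J] (hM : IsMatching I.H M) (hall : ∀ x, ∃ p, (x, p) ∈ M)
    (hβ : I.IsCertificate M β) {i : ℕ} (hi : 1 ≤ i) (hk : i ≤ I.k) {p : J ⊕ A}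
    (hp : ¬ CriticalRight (I.G (i - 1)) p) : β p ≤ I.wt i := by
  by_contra! hlt
  refine hp (hβ.criticalRight hM (b := β p) (fun q hq => ?_) le_rfl)
  have hpos := (I.wt_pos hi hk).trans (hlt.trans_le hq)
  obtain ⟨x, hx⟩ := hβ.exists_mem hpos
  have hcat := (I.wt_lt_weight_iff hi hk).1 ((hlt.trans_le hq).trans_le (hβ.le_weight x q hx))
  exact ⟨x, mem_inter_G.2 ⟨hx, by omega, hβ.mem_first_of_pos hM (i := i)
    (fun j hj => hβ.isMaximum hM hall j (by omega)) hcat.le hx hpos⟩⟩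

/-- The applicants that are matched within `G_i` to a job of value less than `w_i` are critical in
`G_i`, since all neighbours of these jobs are among them. -/
theorem IsCertificate.wt_le_of_not_criticalLeft [Finite J] (hM : IsMatching I.H M)
    (hall : ∀ x, ∃ p, (x, p) ∈ M) (hβ : I.IsCertificate M β) {i : ℕ} (hi : 1 ≤ i) (hk : i ≤ I.k)
    {x : A} {q : J ⊕ A} (hx : ¬ CriticalLeft (I.G i) x) (hq : (x, q) ∈ M ∩ I.G i) :
    I.wt i ≤ β q := by
  by_contra! hlt
  refine hx (criticalLeft_of_closed (Z := {a | ∃ p, (a, p) ∈ M ∩ I.G i ∧ β p < I.wt i})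
    (I.isMatching_inter_G hM i) (fun a ⟨p, hp, _⟩ => ⟨p, hp⟩) ?_ ⟨q, hq, hlt⟩)
  rintro a a' p ⟨p', hp', hpv⟩ hp ha'
  obtain rfl := hM.right_unique hp'.1 hp.1
  have ha := (I.mem_G_iff i _).1 ha'
  by_cases h : ∃ r, r ∈ I.first a' ∧ (a', r) ∈ M
  · obtain ⟨r, hr, hrM⟩ := h
    have hr' : (a', r) ∈ M ∩ I.G i := mem_inter_G.2 ⟨hrM, ha.1, hr⟩
    exact ⟨r, hr', (hβ.le_of_mem_inter_G hr' ha').trans_lt hpv⟩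
  · push Not at h
    have h₁ := hβ.weight_le_of_notMem_first hM hall
      (fun j hj => hβ.isMaximum hM hall j (hj.le.trans (I.cat_le_k a'))) h ha.2
    have h₂ := (I.wt_le_weight_iff hi hk).2 ha.1
    linarith

variable {N : ℕ → Set (A × (J ⊕ A))} {m : ℕ} {s : PruneState A J}

/-- Labels are upper bounds for the values of every certificate of every popular matching `M`. The
alternating paths of the procedure, which refer to `N i`, are exchanged for ones that refer to `M`,
along which values do not decrease. -/
theorem PruneInv.le_lab [Finite J] (hN : ∀ i, 1 ≤ i → i ≤ I.k → IsMaximum (I.G i) (N i))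
    (hM : IsMatching I.H M) (hall : ∀ x, ∃ p, (x, p) ∈ M) (hβ : I.IsCertificate M β)
    (hs : I.PruneInv N m s) {i : ℕ} {p : J ⊕ A} (him : i ≤ m) (hk : i ≤ I.k)
    (hc : CriticalRight (I.G i) p) : (β p : EReal) ≤ s.lab p := by
  induction i using Nat.strong_induction_on generalizing p with
  | _ i ih =>
    obtain ⟨i', hi', hc, hnc⟩ := I.exists_first_critical hc
    rcases hi'.lt_or_eq with h | rfl
    · exact ih i' h (by omega) (by omega) hc
    have h1 := I.one_le_of_criticalRight hc
    have hmax := hβ.isMaximum hM hall i' hk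
    rw [hs.lab_eq i' p him hc hnc]
    refine le_min (EReal.coe_le_coe_iff.2 (hβ.le_wt hM hall h1 hk (hnc _ (by omega))))
      (le_iInf₂ fun x hx => ?_)
    have hcat := I.cat_le_of_criticalLeft hx.1
    obtain ⟨q, hpq, hq⟩ := (altPath_iff hmax.1).1
      (AltPath.of_isMaximum (hN i' h1 hk) hmax hc hx.1 hx.2)
    have hle := hβ.le_of_reach hpq
    refine le_min ?_ (le_iInf₂ fun r hr => ?_)
    · rw [EReal.le_sub_iff_add_le (Or.inl (EReal.coe_ne_bot _)) (Or.inl (EReal.coe_ne_top _)),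
        ← EReal.coe_add]
      refine le_iInf₂ fun r hr => ?_
      obtain ⟨j, hj, hcj⟩ := I.exists_critical_of_lt_first hr.1 hr.2
      refine le_trans (EReal.coe_le_coe_iff.2 ?_) (ih j (by omega) (by omega) (by omega) hcj)
      have := hβ.add_weight_le x r q hq.1 hr.1 (hr.2 q (mem_inter_G.1 hq).2.2)
      linarith
    · obtain ⟨p', hp', hrk⟩ := hr.2.2
      obtain ⟨j, hj, hcj⟩ := I.exists_critical_of_rk_le_first hp' hr.1 hr.2.1 hrk.le
      refine le_trans (EReal.coe_le_coe_iff.2 ?_) (ih j (by omega) (by omega) (by omega) hcj)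
      exact hle.trans (hβ.le_of_rk_eq x r q hq.1 hr.1
        (hrk.trans (I.rk_eq_of_mem_first hp' (mem_inter_G.1 hq).2.2)))

theorem PruneInv.le_lamMin_first [Finite J]
    (hN : ∀ i, 1 ≤ i → i ≤ I.k → IsMaximum (I.G i) (N i))
    (hM : IsMatching I.H M) (hall : ∀ x, ∃ p, (x, p) ∈ M) (hβ : I.IsCertificate M β)
    (hs : I.PruneInv N m s) {x : A} (hx : I.cat x ≤ m + 1) {q : J ⊕ A} (hq : (x, q) ∈ M) :
    ((I.weight x + β q : ℝ) : EReal) ≤ I.lamMin s.lab x (I.first x) := by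
  refine le_iInf₂ fun r hr => ?_
  have hk := I.cat_le_k x
  obtain ⟨j, hj, hc⟩ := I.exists_critical_of_lt_first hr.1 hr.2
  refine le_trans (EReal.coe_le_coe_iff.2 ?_) (hs.le_lab hN hM hall hβ (i := j) (by omega)
    (by omega) hc)
  rw [add_comm]
  refine hβ.add_weight_le x r q hq hr.1 ?_
  by_cases hqf : q ∈ I.first x
  · exact hr.2 q hqf
  · obtain ⟨p, hp⟩ := I.first_nonempty x
    exact (hr.2 p hp).trans (rk_lt_of_notMem_first hM
      (fun j hj => hβ.isMaximum hM hall j (by omega)) hq hqf hp)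

theorem PruneInv.subset_pruneFinal [Finite J]
    (hN : ∀ i, 1 ≤ i → i ≤ I.k → IsMaximum (I.G i) (N i))
    (hM : IsMatching I.H M) (hall : ∀ x, ∃ p, (x, p) ∈ M) (hβ : I.IsCertificate M β)
    (hs : I.PruneInv N m s) (hm : Nonempty A → m = I.k) :
    M ⊆ I.pruneFinal s := by
  rintro ⟨x, q⟩ hq
  have hk := I.cat_le_k x
  obtain rfl := hm ⟨x⟩
  refine ⟨(hs.mem_edges _).2 ⟨?_, fun i him hcat hnc hqf => ?_⟩, ?_⟩
  · by_cases hqf : q ∈ I.first x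
    · exact Or.inl hqf
    · exact Or.inr (hβ.mem_second hM hall hq hqf)
  · simp only at hcat hnc hqf ⊢
    have h1 := (I.one_le_cat x).trans hcat
    have hval := hβ.wt_le_of_not_criticalLeft hM hall h1 him hnc (mem_inter_G.2 ⟨hq, hcat, hqf⟩)
    refine ⟨le_trans (EReal.coe_le_coe_iff.2 (by linarith))
      (hs.le_lamMin_first hN hM hall hβ (hcat.trans (by omega)) hq), le_iInf₂ fun r hr => ?_⟩
    obtain ⟨p, hp, hrk⟩ := hr.2.2
    obtain ⟨j, hj, hc⟩ := I.exists_critical_of_rk_le_first hp hr.1 hr.2.1 hrk.le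
    refine le_trans (EReal.coe_le_coe_iff.2 (hval.trans ?_))
      (hs.le_lab hN hM hall hβ (i := j) (by omega) (by omega) hc)
    exact hβ.le_of_rk_eq x r q hq hr.1 (hrk.trans (I.rk_eq_of_mem_first hp hqf))
  · rintro ⟨hlt, hqs⟩
    simp only at hlt hqs
    refine hlt.not_ge (le_iInf₂ fun r hr => ?_)
    have hrq := hr.2 q hqs
    obtain ⟨j, hj, hc⟩ : ∃ j ≤ I.cat x, CriticalRight (I.G j) r := by
      by_contra! h
      exact hrq.not_ge (hqs.2.2 r ⟨hr.1, h⟩)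
    refine le_trans (EReal.coe_le_coe_iff.2 ?_)
      (hs.le_lab hN hM hall hβ (i := j) (by omega) (by omega) hc)
    linarith [hβ.add_weight_le x r q hq hr.1 hrq, hβ.nonneg q]

end Certificate

end PrefInstance

namespace PrefInstance

variable {A J : Type*} [Fintype A] {I : PrefInstance A J} {M : Set (A × (J ⊕ A))}
  {N : ℕ → Set (A × (J ⊕ A))} {m : ℕ} {s : PruneState A J}

/-! ### The labels form a certificate -/

theorem PruneInv.lab_le_wt (hs : I.PruneInv N m s) {i : ℕ} {p : J ⊕ A} (him : i ≤ m)
    (hc : CriticalRight (I.G i) p) (hnc : ∀ j < i, ¬ CriticalRight (I.G j) p) :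
    s.lab p ≤ I.wt i := by
  rw [hs.lab_eq i p him hc hnc]
  exact min_le_left _ _

theorem PruneInv.lab_nonneg [Finite J] (hs : I.PruneInv N m s) {i : ℕ} {p : J ⊕ A} (him : i ≤ m)
    (hk : i ≤ I.k) (hc : CriticalRight (I.G i) p) : 0 ≤ s.lab p := by
  induction i using Nat.strong_induction_on generalizing p with
  | _ i ih =>
    obtain ⟨i', hi', hc, hnc⟩ := I.exists_first_critical hc
    rcases hi'.lt_or_eq with h | rfl
    · exact ih i' h (by omega) (by omega) hc
    rw [hs.lab_eq i' p him hc hnc]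
    refine le_min (EReal.coe_nonneg.2 (I.wt_pos (I.one_le_of_criticalRight hc) hk).le)
      (le_iInf₂ fun x hx => ?_)
    have hcat := I.cat_le_of_criticalLeft hx.1
    refine le_min ?_ (le_iInf₂ fun r hr => ?_)
    · rw [EReal.le_sub_iff_add_le (Or.inl (EReal.coe_ne_bot _)) (Or.inl (EReal.coe_ne_top _)),
        zero_add]
      exact hs.le_lamMin x (hcat.trans him)
    · obtain ⟨p', hp', hrk⟩ := hr.2.2
      obtain ⟨j, hj, hcj⟩ := I.exists_critical_of_rk_le_first hp' hr.1 hr.2.1 hrk.le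
      exact ih j (by omega) (by omega) (by omega) hcj

/-- Let `p` become critical in `G_i`, and let `y` be reachable from `p` with respect to the
well-formed matching `M`. If `y` is critical in `G_i`, then the definition of the label of `p`
takes `y` into account; otherwise the edges between `y` and its first jobs would have been pruned
if the bounds failed. -/
theorem PruneInv.lab_add_weight_le_of_reach [Finite J]
    (hN : ∀ i, 1 ≤ i → i ≤ I.k → IsMaximum (I.G i) (N i))
    (hs : I.PruneInv N m s) (hM : I.WellFormed M) (hMs : M ⊆ s.edges) {i : ℕ} {p q : J ⊕ A}
    {y : A} (him : i ≤ m) (hk : i ≤ I.k) (hc : CriticalRight (I.G i) p)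
    (hnc : ∀ j < i, ¬ CriticalRight (I.G j) p)
    (hpq : Relation.ReflTransGen (Step (I.G i) (M ∩ I.G i)) p q) (hq : (y, q) ∈ M ∩ I.G i) :
    s.lab p + I.weight y ≤ I.lamMin s.lab y (I.first y) ∧ s.lab p ≤ I.lamEquiv s.lab y := by
  have h1 := I.one_le_of_criticalRight hc
  have hmax := hM.2.1 i h1 hk
  by_cases hy : CriticalLeft (I.G i) y
  · have halt : AltPath (I.G i) (N i) p y :=
      AltPath.of_isMaximum hmax (hN i h1 hk) hc hy ((altPath_iff hmax.1).2 ⟨q, hpq, hq⟩)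
    have hle : s.lab p ≤
        min (I.lamMin s.lab y (I.first y) - (I.weight y : EReal)) (I.lamEquiv s.lab y) := by
      rw [hs.lab_eq i p him hc hnc]
      exact (min_le_right _ _).trans (iInf₂_le y ⟨hy, halt⟩)
    rw [← EReal.le_sub_iff_add_le (Or.inl (EReal.coe_ne_bot _)) (Or.inl (EReal.coe_ne_top _))]
    exact ⟨hle.trans (min_le_left _ _), hle.trans (min_le_right _ _)⟩
  · have hcat := mem_inter_G.1 hq
    have h := ((hs.mem_edges _).1 (hMs hq.1)).2 i him hcat.2.1 hy hcat.2.2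
    have hle := hs.lab_le_wt him hc hnc
    refine ⟨le_trans ?_ h.1, hle.trans h.2⟩
    rw [add_comm, EReal.coe_add]
    exact add_le_add le_rfl hle

open Classical in
/-- The label of a job that is critical in one of the graphs, and `0` for all other jobs. -/
noncomputable def labelValue (I : PrefInstance A J) (s : PruneState A J) (p : J ⊕ A) : ℝ :=
  if ∃ i ≤ I.k, CriticalRight (I.G i) p then (s.lab p).toReal else 0

theorem PruneInv.coe_labelValue [Finite J] (hs : I.PruneInv N m s) (hkm : I.k ≤ m) {p : J ⊕ A}
    {i : ℕ} (hk : i ≤ I.k) (hc : CriticalRight (I.G i) p) :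
    (I.labelValue s p : EReal) = s.lab p := by
  obtain ⟨i', hi', hc', hnc⟩ := I.exists_first_critical hc
  rw [labelValue, if_pos ⟨i, hk, hc⟩, EReal.coe_toReal]
  · exact ne_top_of_le_ne_top (EReal.coe_ne_top _) (hs.lab_le_wt (by omega) hc' hnc)
  · exact ne_bot_of_le_ne_bot EReal.zero_ne_bot (hs.lab_nonneg (by omega) hk hc)

theorem labelValue_eq_zero {p : J ⊕ A} (hp : ∀ i ≤ I.k, ¬ CriticalRight (I.G i) p) :
    I.labelValue s p = 0 :=
  if_neg (by simpa using hp)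

theorem PruneInv.labelValue_nonneg [Finite J] (hs : I.PruneInv N m s) (hkm : I.k ≤ m)
    (p : J ⊕ A) : 0 ≤ I.labelValue s p := by
  by_cases hc : ∃ i ≤ I.k, CriticalRight (I.G i) p
  · obtain ⟨i, hk, hc⟩ := hc
    rw [← EReal.coe_nonneg, hs.coe_labelValue hkm hk hc]
    exact hs.lab_nonneg (by omega) hk hc
  · exact (labelValue_eq_zero (by simpa using hc)).ge

/-- In a well-formed matching, critical jobs are first jobs of their applicants. -/
theorem WellFormed.labelValue_eq_zero [Finite J] (hM : I.WellFormed M) {x : A} {q : J ⊕ A}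
    (hq : (x, q) ∈ M) (hqf : q ∉ I.first x) : I.labelValue s q = 0 := by
  refine PrefInstance.labelValue_eq_zero fun i hk hc => ?_
  obtain ⟨y, hy⟩ := hc _ (hM.2.1 i (I.one_le_of_criticalRight hc) hk)
  obtain rfl := hM.1.left_unique hy.1 hq
  exact hqf (mem_inter_G.1 hy).2.2

theorem PruneInv.labelValue_add_weight_le [Finite J]
    (hN : ∀ i, 1 ≤ i → i ≤ I.k → IsMaximum (I.G i) (N i))
    (hs : I.PruneInv N m s) (hkm : I.k ≤ m) (hM : I.WellFormed M) (hMs : M ⊆ s.edges)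
    {x : A} {q : J ⊕ A} (hq : (x, q) ∈ M) (hqf : q ∈ I.first x) :
    ((I.labelValue s q + I.weight x : ℝ) : EReal) ≤ I.lamMin s.lab x (I.first x) ∧
      (I.labelValue s q : EReal) ≤ I.lamEquiv s.lab x := by
  have hcat := I.cat_le_k x
  by_cases hc : ∃ i ≤ I.k, CriticalRight (I.G i) q
  · obtain ⟨i, hk, hc⟩ := hc
    obtain ⟨i, hi, hc, hnc⟩ := I.exists_first_critical hc
    have hxi : I.cat x ≤ i := not_lt.1 fun h => hqf.1.2 i h hc
    rw [EReal.coe_add, hs.coe_labelValue hkm (by omega) hc]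
    exact hs.lab_add_weight_le_of_reach hN hM hMs (by omega) (by omega) hc hnc .refl
      (mem_inter_G.2 ⟨hq, hxi, hqf⟩)
  · rw [PrefInstance.labelValue_eq_zero (by simpa using hc), zero_add]
    refine ⟨hs.le_lamMin x (by omega), le_iInf₂ fun r hr => ?_⟩
    obtain ⟨p', hp', hrk⟩ := hr.2.2
    obtain ⟨j, hj, hcj⟩ := I.exists_critical_of_rk_le_first hp' hr.1 hr.2.1 hrk.le
    exact hs.lab_nonneg (i := j) (by omega) (by omega) hcj

/-- Among the first jobs of `x`, the job `q` assigned to `x` has the least label. If `q` becomes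
critical in `G_i`, then every other first job `p` is reachable from `q` in `G_i`, hence critical in
`G_i`, and everything that is reachable from `p` in an earlier graph is reachable from `q`. -/
theorem PruneInv.labelValue_le_of_mem_first [Finite J]
    (hN : ∀ i, 1 ≤ i → i ≤ I.k → IsMaximum (I.G i) (N i))
    (hs : I.PruneInv N m s) (hkm : I.k ≤ m) (hM : I.WellFormed M) (hMs : M ⊆ s.edges)
    {x : A} {p q : J ⊕ A} (hq : (x, q) ∈ M) (hqf : q ∈ I.first x) (hpf : p ∈ I.first x) :
    I.labelValue s q ≤ I.labelValue s p := by
  by_cases hc : ∃ i ≤ I.k, CriticalRight (I.G i) q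
  swap
  · rw [PrefInstance.labelValue_eq_zero (by simpa using hc)]
    exact hs.labelValue_nonneg hkm p
  obtain ⟨i₀, hk₀, hc₀⟩ := hc
  obtain ⟨i, hi, hc, hnc⟩ := I.exists_first_critical hc₀
  have hk := hi.trans hk₀
  have hxi : I.cat x ≤ i := not_lt.1 fun h => hqf.1.2 i h hc
  have hstep : Step (I.G i) (M ∩ I.G i) q p :=
    ⟨x, mem_inter_G.2 ⟨hq, hxi, hqf⟩, (I.mem_G_iff i _).2 ⟨hxi, hpf⟩⟩
  have hmax := hM.2.1 i (I.one_le_of_criticalRight hc) hk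
  have hcp := hmax.criticalRight_of_step hc hstep
  obtain ⟨j, hj, hcj, hncj⟩ := I.exists_first_critical hcp
  have h1 := I.one_le_of_criticalRight hcj
  have hmaxj := hM.2.1 j h1 (hj.trans hk)
  rw [← EReal.coe_le_coe_iff, hs.coe_labelValue hkm hk hc,
    hs.coe_labelValue hkm (hj.trans hk) hcj, hs.lab_eq j p (by omega) hcj hncj]
  refine le_min ((hs.lab_le_wt (by omega) hc hnc).trans (EReal.coe_le_coe_iff.2 ?_))
    (le_iInf₂ fun y hy => ?_)
  · rcases hj.eq_or_lt with rfl | hlt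
    · exact le_rfl
    · exact (I.wt_lt_wt h1 hlt hk).le
  · obtain ⟨r, hpr, hr⟩ := (altPath_iff hmaxj.1).1
      (AltPath.of_isMaximum (hN j h1 (hj.trans hk)) hmaxj hcj hy.1 hy.2)
    have hsub := I.G_mono hj
    have hpr' : Relation.ReflTransGen (Step (I.G i) (M ∩ I.G i)) p r :=
      Relation.ReflTransGen.mono
        (fun _ _ ⟨a, h₁, h₂⟩ => ⟨a, ⟨h₁.1, hsub h₁.2⟩, hsub h₂⟩) _ _ hpr
    have h := hs.lab_add_weight_le_of_reach hN hM hMs (by omega) hk hc hnc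
      (hpr'.head hstep) ⟨hr.1, hsub hr.2⟩
    rw [← EReal.le_sub_iff_add_le (Or.inl (EReal.coe_ne_bot _)) (Or.inl (EReal.coe_ne_top _))] at h
    exact le_min h.1 h.2

theorem PruneInv.isCertificate_labelValue [Finite J]
    (hN : ∀ i, 1 ≤ i → i ≤ I.k → IsMaximum (I.G i) (N i))
    (hs : I.PruneInv N m s) (hkm : I.k ≤ m) (hM : I.WellFormed M) (hMG : M ⊆ I.pruneFinal s) :
    I.IsCertificate M (I.labelValue s) := by
  have hMs : M ⊆ s.edges := fun e he => (hMG he).1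
  have hle : ∀ {r : J ⊕ A} {i : ℕ}, i ≤ I.k → CriticalRight (I.G i) r → ∀ {v : ℝ},
      (v : EReal) ≤ s.lab r → v ≤ I.labelValue s r := fun hk hc v hv => by
    rwa [← EReal.coe_le_coe_iff, hs.coe_labelValue hkm hk hc]
  refine ⟨hs.labelValue_nonneg hkm, fun p hp => ?_, fun x q hq => ?_, fun x p q hq hp hlt => ?_,
    fun x p q hq hp heq => ?_⟩
  · refine PrefInstance.labelValue_eq_zero fun i hk hc => ?_
    obtain ⟨y, hy⟩ := hc _ (hM.2.1 i (I.one_le_of_criticalRight hc) hk)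
    exact hp y hy.1
  · by_cases hqf : q ∈ I.first x
    · by_cases hc : ∃ i ≤ I.k, CriticalRight (I.G i) q
      · obtain ⟨i, hk, hc⟩ := hc
        obtain ⟨i', hi', hc, hnc⟩ := I.exists_first_critical hc
        have hxi : I.cat x ≤ i' := not_lt.1 fun h => hqf.1.2 i' h hc
        refine le_trans ?_ ((I.wt_le_weight_iff (I.one_le_of_criticalRight hc) (hi'.trans hk)).2 hxi)
        rw [← EReal.coe_le_coe_iff, hs.coe_labelValue hkm (hi'.trans hk) hc]
        exact hs.lab_le_wt (by omega) hc hnc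
      · rw [PrefInstance.labelValue_eq_zero (by simpa using hc)]
        exact (I.weight_pos x).le
    · rw [hM.labelValue_eq_zero hq hqf]
      exact (I.weight_pos x).le
  · by_cases hqf : q ∈ I.first x
    · have hbetter : ∀ p' ∈ I.first x, I.rk x p < I.rk x p' := fun p' hp' =>
        hlt.trans_eq (I.rk_eq_of_mem_first hqf hp')
      obtain ⟨j, hj, hc⟩ := I.exists_critical_of_lt_first hp hbetter
      exact hle (hj.le.trans (I.cat_le_k x)) hc
        ((hs.labelValue_add_weight_le hN hkm hM hMs hq hqf).1.trans (iInf₂_le p ⟨hp, hbetter⟩))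
    · rw [hM.labelValue_eq_zero hq hqf, zero_add]
      have hqs : q ∈ I.second x := by
        obtain ⟨q', hq', h⟩ := hM.2.2 x
        rw [hM.1.right_unique hq hq'] at hqf ⊢
        exact h.resolve_left hqf
      obtain ⟨j, hj, hc⟩ : ∃ j ≤ I.cat x, CriticalRight (I.G j) p := by
        by_contra! h
        exact hlt.not_ge (hqs.2.2 p ⟨hp, h⟩)
      refine hle (hj.trans (I.cat_le_k x)) hc ?_
      have hfin : (I.weight x : EReal) ≤ I.lamMin s.lab x (I.second x) :=
        not_lt.1 fun h => (hMG hq).2 ⟨h, hqs⟩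
      exact hfin.trans (iInf₂_le p
        ⟨hp, fun p' hp' => hlt.trans_eq (I.rk_eq_of_mem_best hqs.2 hp'.2)⟩)
  · by_cases hqf : q ∈ I.first x
    · by_cases hpf : p ∈ I.first x
      · exact hs.labelValue_le_of_mem_first hN hkm hM hMs hq hqf hpf
      · obtain ⟨j, hj, hc⟩ := I.exists_critical_of_rk_le_first hqf hp hpf heq.le
        exact hle (hj.le.trans (I.cat_le_k x)) hc
          ((hs.labelValue_add_weight_le hN hkm hM hMs hq hqf).2.trans
            (iInf₂_le p ⟨hp, hpf, q, hqf, heq⟩))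
    · rw [hM.labelValue_eq_zero hq hqf]
      exact hs.labelValue_nonneg hkm p

end PrefInstance

theorem mainTheorem3 {A J : Type*} [Fintype A] [Fintype J] (I : PrefInstance A J)
    (N : ℕ → Set (A × (J ⊕ A)))
    (hN : ∀ i, 1 ≤ i → i ≤ I.k → BipMatching.IsMaximum (I.G i) (N i)) :
    (I.pruneTies N = none → ¬ ∃ M, I.Popular M) ∧
    (∀ G' : Set (A × (J ⊕ A)), I.pruneTies N = some G' →
      ∀ M : Set (A × (J ⊕ A)), BipMatching.IsMatching I.H M →
        (I.Popular M ↔ I.WellFormed M ∧ M ⊆ G')) := by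
  have hfold := I.pruneInv_of_foldlM N (I.k - 1)
  constructor
  · rintro hnone ⟨M, hM⟩
    obtain ⟨β, hβ⟩ := hM.exists_isCertificate
    obtain ⟨m, s, -, -, hs, hearly⟩ := hfold.2 (by simpa [PrefInstance.pruneTies] using hnone)
    obtain ⟨x, hx, hlt⟩ := I.exists_lt_of_pruneStep_eq_none hearly
    obtain ⟨q, hq⟩ := hM.exists_mem x
    refine hlt.not_ge (le_trans (EReal.coe_le_coe_iff.2 ?_)
      (hs.le_lamMin_first hN hM.1 hM.exists_mem hβ hx.le hq))
    rw [← hx, I.wt_cat]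
    linarith [hβ.nonneg q]
  · intro G' hG' M hM
    obtain ⟨s, hs, rfl⟩ := Option.map_eq_some_iff.1 hG'
    have hinv := hfold.1 s hs
    constructor
    · intro hpop
      obtain ⟨β, hβ⟩ := hpop.exists_isCertificate
      refine ⟨hβ.wellFormed hM hpop.exists_mem,
        hinv.subset_pruneFinal hN hM hpop.exists_mem hβ ?_⟩
      rintro ⟨x⟩
      have := (I.one_le_cat x).trans (I.cat_le_k x)
      omega
    · rintro ⟨hwf, hsub⟩
      exact I.popular_of_isCertificate hM (fun x => (hwf.2.2 x).imp fun _ h => h.1)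
        (hinv.isCertificate_labelValue hN (by omega) hwf hsub)
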